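/- Let $X$ be a complex Hilbert space and let $A$ be a Riesz-spectral operator on $X$: $A$ is closed, its eigenvalues are the simple, pairwise distinct numbers $(\lambda_n)_{n\in\mathbb N}$, the corresponding eigenvectors $(\phi_n)$ form a Riesz basis of $X$, and $\{\lambda_n\}$ has at most finitely many accumulation points. Let $(\psi_n)$ be the sequence biorthogonal to $(\phi_n)$. Let $A$ generate the $C_0$-semigroup $(T(t))_{t\ge 0}$, let $b,f\in X$, put $Bu=bu$ ($u\in\mathbb C$), $Fx=\langle x,f\rangle$ ($x\in X$) and $S(\tau)u=\int_0^\tau T(s)Bu\,ds$. Write $R(z,L)=(zI-L)^{-1}$. Assume: (A1) there are $\omega,\alpha,\Upsilon>0$ such that only finitely many elements of $\{\lambda_n\}$ lie in $\{\operatorname{Re}\lambda>-\omega\}\setminus\Omega_{\alpha,\Upsilon}$, where $\Omega_{\alpha,\Upsilon}=\{\lambda\in\mathbb C\setminus\mathbb R:\operatorname{Re}\lambda\le-\Upsilon/|\operatorname{Im}\lambda|^{\alpha}\}$; (A2) no $\lambda_n$ lies on $i\mathbb R$. Let $\beta,\gamma\ge 0$ with $\beta+\gamma\ge\alpha$, and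 let $b\in\mathcal D^{\beta}$ and $f\in\mathcal D^{\gamma}_*$, that is, $\sum_n|\lambda_n|^{2\beta}|\langle b,\psi_n\rangle|^2<\infty$ and $\sum_n|\lambda_n|^{2\gamma}|\langle f,\phi_n\rangle|^2<\infty$. Fix $\tau>0$. Then the following hold. (a) For all $r>1$ sufficiently close to $1$ the circle $|z|=r$ lies in $\rho(T(\tau))$, and $$\lim_{r\downarrow1}\,(r-1)\int_0^{2\pi}\|R(re^{i\theta},T(\tau))S(\tau)\|^2\,\|FR(re^{i\theta},T(\tau))\|^2\,d\theta=0.$$ (b) Let $\Phi$ be a smooth, positively oriented, simple closed curve in $\rho(A)$ containing $\sigma(A)\cap\{\operatorname{Re}\lambda>0\}$ in its interior and $\sigma(A)\cap\{\operatorname{Re}\lambda\le0\}$ in its exterior. Let $\Pi=\frac1{2\pi i}\int_\Phi(\lambda I-A)^{-1}d\lambda$, $X^+=\Pi X$, $X^-=(I-\Pi)X$, $T^{\pm}(t)=T(t)|_{X^\pm}$, $F^\pm=F|_{X^\pm}$, $A^-=A|_{X^-}$. Let $0<\delta\le\alpha/2$, and suppose that $\delta\le1$ or $\beta\ge\alpha$.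 Then for all $r>1$ sufficiently close to $1$ the circle $|z|=r$ lies in $\rho(T^+(\tau))\cap\rho(T^-(\tau))$, and $$\lim_{r\downarrow1}\Lambda_{\delta/\alpha}(r)\int_0^{2\pi}\|R(re^{i\theta},T(\tau))S(\tau)\|^2\,\|F^+R(re^{i\theta},T^+(\tau))\|^2\,d\theta=0,$$ $$\lim_{r\downarrow1}\Lambda_{\delta/\alpha}(r)\int_0^{2\pi}\|R(re^{i\theta},T(\tau))S(\tau)\|^2\,\|F^-R(re^{i\theta},T^-(\tau))(-A^-)^{-\delta}\|^2\,d\theta=0,$$ where $\Lambda_{\eta}(r)=(r-1)^{1-2\eta}$ for $0<\eta<1/2$, $\Lambda_{1/2}(r)=|\log(r-1)|^{-1}$, and $(-A^-)^{-\delta}$ is the fractional power of the sectorial, boundedly invertible operator $-A^-$ on $X^-$. -/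

import Mathlib

open Filter Topology MeasureTheory

namespace SampledData

/-! ### Strongly continuous semigroups -/

/-- A `C₀`-semigroup `(T(t))_{t ≥ 0}` of bounded operators. Only the values at `t ≥ 0` matter. -/
structure C0Semigroup (X : Type*) [NormedAddCommGroup X] [NormedSpace ℂ X] where
  toFun : ℝ → X →L[ℂ] X
  map_zero' : toFun 0 = ContinuousLinearMap.id ℂ X
  map_add' : ∀ s t : ℝ, 0 ≤ s → 0 ≤ t → toFun (s + t) = toFun s ∘L toFun t
  continuousOn' : ∀ x : X, ContinuousOn (fun t => toFun t x) (Set.Ici 0)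

instance {X : Type*} [NormedAddCommGroup X] [NormedSpace ℂ X] :
    CoeFun (C0Semigroup X) (fun _ => ℝ → X →L[ℂ] X) := ⟨C0Semigroup.toFun⟩

/-- `A` is the generator of the semigroup `T`: one has `x ∈ D(A)` and `A x = y` exactly when
`(T(h) x - x) / h → y` as `h ↓ 0`. -/
def C0Semigroup.IsGenerator {X : Type*} [NormedAddCommGroup X] [NormedSpace ℂ X]
    (T : C0Semigroup X) (A : X →ₗ.[ℂ] X) : Prop :=
  ∀ x y : X, (x, y) ∈ A.graph ↔
    Tendsto (fun h : ℝ => ((h : ℂ))⁻¹ • (T h x - x)) (𝓝[>] 0) (𝓝 y)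

/-! ### Resolvents, contour projections and fractional powers of unbounded operators -/

/-- `R` is the bounded everywhere defined inverse of `z I - A : D(A) → E`: for all `x, y`, one has
`R x = y` iff `y ∈ D(A)` and `z y - A y = x`. -/
def IsResolventAt {E : Type*} [NormedAddCommGroup E] [NormedSpace ℂ E]
    (A : E →ₗ.[ℂ] E) (z : ℂ) (R : E →L[ℂ] E) : Prop :=
  ∀ x y : E, R x = y ↔ (y, z • y - x) ∈ A.graph

/-- The resolvent set `ρ(A)` of a (possibly unbounded) operator. -/
def opResolventSet {E : Type*} [NormedAddCommGroup E] [NormedSpace ℂ E]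
    (A : E →ₗ.[ℂ] E) : Set ℂ :=
  {z | ∃ R : E →L[ℂ] E, IsResolventAt A z R}

/-- The spectrum `σ(A)` of a (possibly unbounded) operator. -/
def opSpectrum {E : Type*} [NormedAddCommGroup E] [NormedSpace ℂ E]
    (A : E →ₗ.[ℂ] E) : Set ℂ :=
  (opResolventSet A)ᶜ

open Classical in
/-- The resolvent `R(z, A) = (z I - A)⁻¹` for `z ∈ ρ(A)` (and `0` otherwise). -/
noncomputable def opResolvent {E : Type*} [NormedAddCommGroup E] [NormedSpace ℂ E]
    (A : E →ₗ.[ℂ] E) (z : ℂ) : E →L[ℂ] E :=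
  if h : ∃ R : E →L[ℂ] E, IsResolventAt A z R then h.choose else 0

/-- The winding number of the closed curve `Φ : [0, 2π] → ℂ` around `w`. -/
noncomputable def windingNumber (Φ : ℝ → ℂ) (w : ℂ) : ℂ :=
  (2 * (Real.pi : ℂ) * Complex.I)⁻¹ * ∫ t in (0 : ℝ)..(2 * Real.pi), deriv Φ t / (Φ t - w)

/-- `Φ` is a smooth, positively oriented, simple closed curve in `ρ(A)` which contains
`σ(A) ∩ {Re > 0}` in its interior and `σ(A) ∩ {Re ≤ 0}` in its exterior. For a positively oriented
simple closed curve the interior (exterior) consists of the points off the curve with winding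
number one (zero). -/
structure IsSeparatingContour {E : Type*} [NormedAddCommGroup E] [NormedSpace ℂ E]
    (A : E →ₗ.[ℂ] E) (Φ : ℝ → ℂ) : Prop where
  smooth : ContDiff ℝ (⊤ : ℕ∞) Φ
  periodic : Function.Periodic Φ (2 * Real.pi)
  regular : ∀ t : ℝ, deriv Φ t ≠ 0
  simple : Set.InjOn Φ (Set.Ico 0 (2 * Real.pi))
  mem_resolventSet : ∀ t : ℝ, Φ t ∈ opResolventSet A
  interior : ∀ z ∈ opSpectrum A, 0 < z.re → windingNumber Φ z = 1
  exterior : ∀ z ∈ opSpectrum A, z.re ≤ 0 → windingNumber Φ z = 0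

/-- The spectral projection `Π = (2πi)⁻¹ ∫_Φ (λ I - A)⁻¹ dλ`. -/
noncomputable def spectralProj {E : Type*} [NormedAddCommGroup E] [NormedSpace ℂ E]
    (A : E →ₗ.[ℂ] E) (Φ : ℝ → ℂ) : E →L[ℂ] E :=
  (2 * (Real.pi : ℂ) * Complex.I)⁻¹ •
    ∫ t in (0 : ℝ)..(2 * Real.pi), deriv Φ t • opResolvent A (Φ t)

/-- The subspace `X⁺ = Π X`. -/
noncomputable def plusSpace {E : Type*} [NormedAddCommGroup E] [NormedSpace ℂ E]
    (A : E →ₗ.[ℂ] E) (Φ : ℝ → ℂ) : Submodule ℂ E :=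
  LinearMap.range (spectralProj A Φ).toLinearMap

/-- The subspace `X⁻ = (I - Π) X`. -/
noncomputable def minusSpace {E : Type*} [NormedAddCommGroup E] [NormedSpace ℂ E]
    (A : E →ₗ.[ℂ] E) (Φ : ℝ → ℂ) : Submodule ℂ E :=
  LinearMap.range (ContinuousLinearMap.id ℂ E - spectralProj A Φ).toLinearMap

/-- The restriction of the operator `A` to a subspace `S`, as an operator in `S`: its graph is the
set of those `(x, A x)` with `x ∈ D(A)`, `x ∈ S` and `A x ∈ S` (the last condition is automatic
when `S` is invariant). -/
noncomputable def opPart {E : Type*} [NormedAddCommGroup E] [NormedSpace ℂ E]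
    (A : E →ₗ.[ℂ] E) (S : Submodule ℂ E) : S →ₗ.[ℂ] S :=
  (A.graph.comap (S.subtype.prodMap S.subtype)).toLinearPMap

theorem mem_graph_opPart {E : Type*} [NormedAddCommGroup E] [NormedSpace ℂ E]
    (A : E →ₗ.[ℂ] E) (S : Submodule ℂ E) (x y : S) :
    (x, y) ∈ (opPart A S).graph ↔ ((x : E), (y : E)) ∈ A.graph := by
  unfold opPart
  rw [Submodule.toLinearPMap_graph_eq]
  · rfl
  · rintro ⟨u, v⟩ h hu
    have hu' : u = 0 := hu
    subst hu'
    exact Subtype.ext (A.graph_fst_eq_zero_snd h rfl)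

open Classical in
/-- The negative fractional power `(-A)^{-δ}`, `δ > 0`, of an operator `A` such that `-A` is
sectorial and `0 ∈ ρ(A)`. With `n = ⌊δ⌋` and `s = δ - n ∈ [0, 1)` it is
`(-A)^{-n} (-A)^{-s}`, where `(-A)^{-1} = R(0, A)`, and where, for `0 < s < 1`,
`(-A)^{-s} = (sin (π s) / π) ∫_0^∞ t^{-s} (t I - A)⁻¹ dt` (Balakrishnan's formula). -/
noncomputable def negFracPow {E : Type*} [NormedAddCommGroup E] [NormedSpace ℂ E]
    (A : E →ₗ.[ℂ] E) (δ : ℝ) : E →L[ℂ] E :=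
  (opResolvent A 0) ^ ⌊δ⌋₊ *
    (if Int.fract δ = 0 then 1
      else ((Real.sin (Real.pi * Int.fract δ) / Real.pi : ℝ) : ℂ) •
        ∫ t in Set.Ioi (0 : ℝ), ((t ^ (-Int.fract δ) : ℝ) : ℂ) • opResolvent A (t : ℂ))

/-! ### Invariance of the spectral subspaces under the semigroup -/

theorem graph_semigroup {X : Type*} [NormedAddCommGroup X] [NormedSpace ℂ X]
    {T : C0Semigroup X} {A : X →ₗ.[ℂ] X} (hT : T.IsGenerator A) {t : ℝ} (ht : 0 ≤ t)
    {x y : X} (h : (x, y) ∈ A.graph) : (T t x, T t y) ∈ A.graph := by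
  rw [hT] at h ⊢
  have h1 := ((T t).continuous.tendsto y).comp h
  refine h1.congr' ?_
  filter_upwards [self_mem_nhdsWithin] with s hs
  have hs' : (0 : ℝ) ≤ s := le_of_lt hs
  have e : T s (T t x) = T t (T s x) := by
    have e1 := congrArg (fun L => L x) (T.map_add' s t hs' ht)
    have e2 := congrArg (fun L => L x) (T.map_add' t s ht hs')
    simp only [ContinuousLinearMap.comp_apply] at e1 e2
    rw [← e1, ← e2, add_comm]
  simp only [Function.comp_apply, map_smul, map_sub, e]

theorem opResolvent_comm {X : Type*} [NormedAddCommGroup X] [NormedSpace ℂ X]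
    {T : C0Semigroup X} {A : X →ₗ.[ℂ] X} (hT : T.IsGenerator A) {t : ℝ} (ht : 0 ≤ t) (z : ℂ) :
    opResolvent A z * T t = T t * opResolvent A z := by
  unfold opResolvent
  split_ifs with h
  · have hR := h.choose_spec
    ext x
    have h1 := graph_semigroup hT ht ((hR x _).1 rfl)
    rw [map_sub, map_smul] at h1
    exact (hR (T t x) _).2 h1
  · simp

theorem spectralProj_comm {X : Type*} [NormedAddCommGroup X] [NormedSpace ℂ X]
    {T : C0Semigroup X} {A : X →ₗ.[ℂ] X} (hT : T.IsGenerator A) {t : ℝ} (ht : 0 ≤ t)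
    (Φ : ℝ → ℂ) : spectralProj A Φ * T t = T t * spectralProj A Φ := by
  unfold spectralProj
  rw [smul_mul_assoc, mul_smul_comm]
  congr 1
  by_cases hX : CompleteSpace (X →L[ℂ] X)
  swap
  · simp [intervalIntegral, integral, hX]
  by_cases hi : IntervalIntegrable (fun s => deriv Φ s • opResolvent A (Φ s)) volume 0
      (2 * Real.pi)
  · have h1 := ((ContinuousLinearMap.mul ℂ (X →L[ℂ] X)).flip (T t)).intervalIntegral_comp_comm hi
    have h2 := ((ContinuousLinearMap.mul ℂ (X →L[ℂ] X)) (T t)).intervalIntegral_comp_comm hi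
    simp only [ContinuousLinearMap.flip_apply, ContinuousLinearMap.mul_apply'] at h1 h2
    rw [← h1, ← h2]
    congr 1
    ext1 s
    rw [smul_mul_assoc, mul_smul_comm, opResolvent_comm hT ht]
  · rw [intervalIntegral.integral_undef hi]
    simp

theorem mapsTo_plusSpace {X : Type*} [NormedAddCommGroup X] [NormedSpace ℂ X]
    {T : C0Semigroup X} {A : X →ₗ.[ℂ] X} (hT : T.IsGenerator A) {t : ℝ} (ht : 0 ≤ t)
    (Φ : ℝ → ℂ) : Set.MapsTo (T t) (plusSpace A Φ) (plusSpace A Φ) := by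
  rintro _ ⟨x, rfl⟩
  exact ⟨T t x, congrArg (fun L => L x) (spectralProj_comm hT ht Φ)⟩

theorem mapsTo_minusSpace {X : Type*} [NormedAddCommGroup X] [NormedSpace ℂ X]
    {T : C0Semigroup X} {A : X →ₗ.[ℂ] X} (hT : T.IsGenerator A) {t : ℝ} (ht : 0 ≤ t)
    (Φ : ℝ → ℂ) : Set.MapsTo (T t) (minusSpace A Φ) (minusSpace A Φ) := by
  rintro _ ⟨x, rfl⟩
  refine ⟨T t x, ?_⟩
  have h : spectralProj A Φ (T t x) = T t (spectralProj A Φ x) :=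
    congrArg (fun L => L x) (spectralProj_comm hT ht Φ)
  simp [h]

/-- `T⁺(t) = T(t)|_{X⁺}`, as a bounded operator on `X⁺`. -/
noncomputable def semigroupPlus {X : Type*} [NormedAddCommGroup X] [NormedSpace ℂ X]
    {T : C0Semigroup X} {A : X →ₗ.[ℂ] X} (hT : T.IsGenerator A) {t : ℝ} (ht : 0 ≤ t)
    (Φ : ℝ → ℂ) : plusSpace A Φ →L[ℂ] plusSpace A Φ :=
  (T t).restrict (mapsTo_plusSpace hT ht Φ)

/-- `T⁻(t) = T(t)|_{X⁻}`, as a bounded operator on `X⁻`. -/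
noncomputable def semigroupMinus {X : Type*} [NormedAddCommGroup X] [NormedSpace ℂ X]
    {T : C0Semigroup X} {A : X →ₗ.[ℂ] X} (hT : T.IsGenerator A) {t : ℝ} (ht : 0 ≤ t)
    (Φ : ℝ → ℂ) : minusSpace A Φ →L[ℂ] minusSpace A Φ :=
  (T t).restrict (mapsTo_minusSpace hT ht Φ)

/-- `A⁻ = A|_{X⁻}`, as an operator in `X⁻`. -/
noncomputable def opMinus {X : Type*} [NormedAddCommGroup X] [NormedSpace ℂ X]
    (A : X →ₗ.[ℂ] X) (Φ : ℝ → ℂ) : minusSpace A Φ →ₗ.[ℂ] minusSpace A Φ :=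
  opPart A (minusSpace A Φ)

/-! ### The input operator of the discretized system -/

/-- `S(τ) u = ∫_0^τ T(s) B u ds`. -/
noncomputable def inputMap {X : Type*} [NormedAddCommGroup X] [NormedSpace ℂ X]
    (T : C0Semigroup X) (B : ℂ →L[ℂ] X) (τ : ℝ) : ℂ →L[ℂ] X :=
  LinearMap.toContinuousLinearMap
    { toFun := fun u => ∫ s in (0 : ℝ)..τ, T s (B u)
      map_add' := fun u v => by
        have h : ∀ w : ℂ, ∫ s in (0 : ℝ)..τ, T s (B w) = w • ∫ s in (0 : ℝ)..τ, T s (B 1) := by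
          intro w
          rw [← intervalIntegral.integral_smul]
          congr 1
          ext1 s
          rw [← map_smul, ← map_smul, smul_eq_mul, mul_one]
        rw [h (u + v), h u, h v, add_smul]
      map_smul' := fun c u => by
        rw [RingHom.id_apply, ← intervalIntegral.integral_smul]
        congr 1
        ext1 s
        rw [map_smul, map_smul] }

theorem inputMap_apply {X : Type*} [NormedAddCommGroup X] [NormedSpace ℂ X]
    (T : C0Semigroup X) (B : ℂ →L[ℂ] X) (τ : ℝ) (u : ℂ) :
    inputMap T B τ u = ∫ s in (0 : ℝ)..τ, T s (B u) := rfl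

/-! ### Riesz-spectral operators -/

/-- `φ` is a Riesz basis of `X`: its span is dense and `‖∑ cₙ φₙ‖²` is equivalent to `∑ |cₙ|²`
on finite sums. -/
structure IsRieszBasis {X : Type*} [NormedAddCommGroup X] [InnerProductSpace ℂ X]
    (φ : ℕ → X) : Prop where
  dense_span : (Submodule.span ℂ (Set.range φ)).topologicalClosure = ⊤
  bounds : ∃ m M : ℝ, 0 < m ∧ 0 < M ∧ ∀ (s : Finset ℕ) (c : ℕ → ℂ),
    m * ∑ n ∈ s, ‖c n‖ ^ 2 ≤ ‖∑ n ∈ s, c n • φ n‖ ^ 2 ∧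
      ‖∑ n ∈ s, c n • φ n‖ ^ 2 ≤ M * ∑ n ∈ s, ‖c n‖ ^ 2

/-- `A` is a Riesz-spectral operator: it is closed, its eigenvalues are the pairwise distinct simple
eigenvalues `lam n` with eigenvectors `φ n`, the sequence `φ` is a Riesz basis, and the set of
eigenvalues has at most finitely many accumulation points. -/
structure IsRieszSpectral {X : Type*} [NormedAddCommGroup X] [InnerProductSpace ℂ X]
    (A : X →ₗ.[ℂ] X) (lam : ℕ → ℂ) (φ : ℕ → X) : Prop where
  closed : A.IsClosed
  injective : Function.Injective lam
  eigenvalues : ∀ μ : ℂ, (∃ x : X, x ≠ 0 ∧ (x, μ • x) ∈ A.graph) ↔ μ ∈ Set.range lam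
  eigenspace : ∀ (n : ℕ) (x : X), (x, lam n • x) ∈ A.graph ↔ x ∈ Submodule.span ℂ {φ n}
  rieszBasis : IsRieszBasis φ
  finite_accPt : {z : ℂ | AccPt z (𝓟 (Set.range lam))}.Finite

/-- The sequences `φ` and `ψ` are biorthogonal. For a Riesz basis `φ` of eigenvectors of `A` this
determines `ψ`, which then consists of eigenvectors of `A*`. -/
def Biorthogonal {X : Type*} [NormedAddCommGroup X] [InnerProductSpace ℂ X]
    (φ ψ : ℕ → X) : Prop :=
  ∀ n m : ℕ, inner ℂ (ψ m) (φ n) = if n = m then (1 : ℂ) else 0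

/-- For the biorthogonal sequence `χ = ψ` this is `𝒟^β`, and for `χ = φ` it is `𝒟_*^β`:
the set of all `x` with `∑ₙ |λₙ|^{2β} |⟨x, χₙ⟩|² < ∞`. (Mathlib's inner product is linear in its
second argument.) -/
def weightedDomain {X : Type*} [NormedAddCommGroup X] [InnerProductSpace ℂ X]
    (lam : ℕ → ℂ) (χ : ℕ → X) (β : ℝ) : Set X :=
  {x | Summable fun n : ℕ => ‖lam n‖ ^ (2 * β) * ‖(inner ℂ (χ n) x : ℂ)‖ ^ 2}

/-- The set `Ω_{α,Υ}` of all non-real `z` with `Re z ≤ -Υ / |Im z|^α`. -/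
def OmegaSet (α Υ : ℝ) : Set ℂ :=
  {z | z.im ≠ 0 ∧ z.re ≤ -Υ / |z.im| ^ α}

open Classical in
/-- The weight `Λ_δ(r)`, `0 < δ ≤ 1/2`, `r > 1`. -/
noncomputable def weightLambda (δ r : ℝ) : ℝ :=
  if δ = 1 / 2 then |Real.log (r - 1)|⁻¹ else (r - 1) ^ (1 - 2 * δ)

/-- The point `r e^{iθ}`. -/
noncomputable def circlePt (r θ : ℝ) : ℂ := (r : ℂ) * Complex.exp (Complex.I * (θ : ℂ))

end SampledData

open SampledData

/-! In the coordinates ⟨x, ψₙ⟩ of the Riesz basis the norm is equivalent to the ℓ² norm and every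
operator involved is diagonal: `A` is multiplication by λₙ on its maximal domain
(`IsRieszSpectral.mem_graph_iff`), T(τ) has multipliers pₙ = exp(λₙτ), Π keeps the coordinates with
Re λₙ > 0 and kills the others, and (-A⁻)^{-δ} is bounded by multiples of |λₙ|^{-δ}
(`IsDiagonalOp.coord_negFracPow_le`). X, X⁺ and X⁻ are treated at once as spaces of vectors whose
coordinates vanish outside an index set.

Only finitely many pₙ lie outside the closed unit disc. They stay away from the circle |z| = r as r
↓ 1, so replacing them by 0 costs a constant; call the new sequence qₙ. The squared input and output
norms are then bounded by C ∑ gₙ|z - qₙ|⁻² and C ∑ hₙ|z - qₙ|⁻² (`exists_norm_sq_input_le`,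
`exists_norm_sq_output_le`).

Assumption (A1) says that |λₙ|^{-α} ≤ K(1 - |qₙ|) ≤ K|z - qₙ| (`exists_rpow_neg_le`). Hence a weight
|λₙ|^{2e} in the coefficients buys a factor |z - qₙ|^{2e/α}. With 2e = 2a on the input side and 2e =
2(α - a + δ) on the output side, the remaining negative exponents add up to s = 2 - 2δ/α. By
interpolation the product of the two sums is at most a constant times one sum t(z) = ∑ dₙ|z -
qₙ|^{-s} with summable d (`tendsto_weightLambda_mul_integral_mul`). The exponent a that makes both
weighted sums converge comes from `exists_input_exponent`.

The weight Λ_{δ/α}(r) is the order of the circle integral of |z - q|^{-s} as q approaches the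
circle: weight times integral is bounded uniformly in |q| ≤ 1, and tends to 0 for each fixed |q| <
1. Dominated convergence over n finishes the argument. Part (a) is the case δ = 0, where Λ₀(r) = r -
1. -/

namespace SampledData

/-! ### Coordinates with respect to a Riesz basis -/

section RieszBasis

variable {X : Type*} [NormedAddCommGroup X] [InnerProductSpace ℂ X] {φ ψ : ℕ → X}

theorem Biorthogonal.inner_sum (hψ : Biorthogonal φ ψ) (s : Finset ℕ) (c : ℕ → ℂ) (k : ℕ) :
    (inner ℂ (ψ k) (∑ n ∈ s, c n • φ n) : ℂ) = if k ∈ s then c k else 0 := by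
  rw [_root_.inner_sum]
  simp only [inner_smul_right]
  have h : ∀ n ∈ s, c n * (inner ℂ (ψ k) (φ n) : ℂ) = if n = k then c n else 0 := by
    intro n _
    rw [hψ n k]
    split_ifs <;> simp
  rw [Finset.sum_congr rfl h]
  simp

theorem IsRieszBasis.dense (hφ : IsRieszBasis φ) :
    Dense (Submodule.span ℂ (Set.range φ) : Set X) :=
  (Submodule.dense_iff_topologicalClosure_eq_top).2 hφ.dense_span

theorem exists_finset_sum_of_mem_span {x : X} (hx : x ∈ Submodule.span ℂ (Set.range φ)) :
    ∃ (s : Finset ℕ) (c : ℕ → ℂ), x = ∑ n ∈ s, c n • φ n := by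
  obtain ⟨c, rfl⟩ := (Finsupp.mem_span_range_iff_exists_finsupp).1 hx
  exact ⟨c.support, c, rfl⟩

/-- On the span this is the lower Riesz bound. For a fixed finite set the inequality is a closed
condition, and the span is dense. -/
theorem IsRieszBasis.bessel (hφ : IsRieszBasis φ) (hψ : Biorthogonal φ ψ) :
    ∃ C : ℝ, 0 < C ∧ ∀ (x : X) (s : Finset ℕ),
      ∑ n ∈ s, ‖(inner ℂ (ψ n) x : ℂ)‖ ^ 2 ≤ C * ‖x‖ ^ 2 := by
  obtain ⟨m, M, hm, hM, h⟩ := hφ.bounds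
  refine ⟨m⁻¹, inv_pos.2 hm, fun x s => ?_⟩
  have hc : IsClosed {x : X | ∑ n ∈ s, ‖(inner ℂ (ψ n) x : ℂ)‖ ^ 2 ≤ m⁻¹ * ‖x‖ ^ 2} :=
    isClosed_le (by fun_prop) (by fun_prop)
  have hsub : (Submodule.span ℂ (Set.range φ) : Set X) ⊆
      {x : X | ∑ n ∈ s, ‖(inner ℂ (ψ n) x : ℂ)‖ ^ 2 ≤ m⁻¹ * ‖x‖ ^ 2} := by
    intro y hy
    obtain ⟨t, c, rfl⟩ := exists_finset_sum_of_mem_span hy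
    rw [Set.mem_ofPred_eq, inv_mul_eq_div, le_div_iff₀' hm]
    refine le_trans (mul_le_mul_of_nonneg_left ?_ hm.le) (h t c).1
    calc ∑ n ∈ s, ‖(inner ℂ (ψ n) (∑ n ∈ t, c n • φ n) : ℂ)‖ ^ 2
        = ∑ n ∈ s, if n ∈ t then ‖c n‖ ^ 2 else 0 := by
          refine Finset.sum_congr rfl fun n _ => ?_
          rw [hψ.inner_sum]
          split_ifs <;> simp
      _ = ∑ n ∈ s ∩ t, ‖c n‖ ^ 2 := by rw [Finset.sum_ite_mem]
      _ ≤ ∑ n ∈ t, ‖c n‖ ^ 2 :=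
          Finset.sum_le_sum_of_subset_of_nonneg Finset.inter_subset_right
            fun _ _ _ => by positivity
  have := closure_minimal hsub hc
  rw [hφ.dense.closure_eq] at this
  exact this (Set.mem_univ x)

theorem IsRieszBasis.summable_coord (hφ : IsRieszBasis φ) (hψ : Biorthogonal φ ψ) (x : X) :
    Summable fun n => ‖(inner ℂ (ψ n) x : ℂ)‖ ^ 2 := by
  obtain ⟨C, -, h⟩ := hφ.bessel hψ
  exact summable_of_sum_le (fun _ => by positivity) (h x)

/-- If all coordinates of z vanish and u in the span approximates z, the coefficients of u are the
coordinates of u - z. The two Riesz bounds then give ‖u‖² ≤ MC‖u - z‖², so u tends to 0 as well as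
to z. -/
theorem IsRieszBasis.ext_coord (hφ : IsRieszBasis φ) (hψ : Biorthogonal φ ψ) {x y : X}
    (hxy : ∀ n, (inner ℂ (ψ n) x : ℂ) = inner ℂ (ψ n) y) : x = y := by
  obtain ⟨C, hC, hB⟩ := hφ.bessel hψ
  obtain ⟨m, M, hm, hM, h⟩ := hφ.bounds
  have hz : ∀ z : X, (∀ n, (inner ℂ (ψ n) z : ℂ) = 0) → z = 0 := by
    intro z hz
    obtain ⟨u, hu, hul⟩ := mem_closure_iff_seq_limit.1 (hφ.dense z)
    have h1 : ∀ k, ‖u k‖ ^ 2 ≤ M * (C * ‖u k - z‖ ^ 2) := by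
      intro k
      obtain ⟨t, c, hc⟩ := exists_finset_sum_of_mem_span (hu k)
      have h2 := hB (u k - z) t
      have h3 : ∑ n ∈ t, ‖(inner ℂ (ψ n) (u k - z) : ℂ)‖ ^ 2 = ∑ n ∈ t, ‖c n‖ ^ 2 := by
        refine Finset.sum_congr rfl fun n hn => ?_
        rw [inner_sub_right, hz n, sub_zero, hc, hψ.inner_sum, if_pos hn]
      rw [h3] at h2
      have h4 := (h t c).2
      rw [← hc] at h4
      exact h4.trans (mul_le_mul_of_nonneg_left h2 hM.le)
    have h5 : Tendsto (fun k => ‖u k‖ ^ 2) atTop (𝓝 (‖z‖ ^ 2)) := (hul.norm).pow 2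
    have h6 : Tendsto (fun k => M * (C * ‖u k - z‖ ^ 2)) atTop (𝓝 (M * (C * ‖z - z‖ ^ 2))) :=
      (((hul.sub_const z).norm.pow 2).const_mul C).const_mul M
    have h7 := le_of_tendsto_of_tendsto' h5 h6 h1
    simp only [sub_self, norm_zero] at h7
    have : ‖z‖ ^ 2 ≤ 0 := by simpa using h7
    simpa using le_antisymm this (by positivity)
  exact sub_eq_zero.1 (hz (x - y) fun n => by rw [inner_sub_right, hxy n, sub_self])

theorem inner_tsum_smul (hψ : Biorthogonal φ ψ) {c : ℕ → ℂ}
    (hc : Summable fun n => c n • φ n) (k : ℕ) :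
    (inner ℂ (ψ k) (∑' n, c n • φ n) : ℂ) = c k := by
  have h1 := (innerSL ℂ (ψ k)).hasSum hc.hasSum
  have h2 : HasSum (fun n => innerSL ℂ (ψ k) (c n • φ n)) (c k) := by
    convert hasSum_single k ?_ using 1
    · simp [hψ k k]
    · intro n hn
      simp [hψ n k, hn]
  exact h1.unique h2

variable [CompleteSpace X]

theorem IsRieszBasis.summable_smul (hφ : IsRieszBasis φ) {c : ℕ → ℂ}
    (hc : Summable fun n => ‖c n‖ ^ 2) : Summable fun n => c n • φ n := by
  obtain ⟨m, M, hm, hM, h⟩ := hφ.bounds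
  rw [summable_iff_vanishing_norm]
  intro ε hε
  obtain ⟨s, hs⟩ := (summable_iff_vanishing_norm.1 hc) (ε ^ 2 / M) (by positivity)
  refine ⟨s, fun t ht => ?_⟩
  have h1 := hs t ht
  rw [Real.norm_of_nonneg (Finset.sum_nonneg fun _ _ => by positivity), lt_div_iff₀' hM] at h1
  exact lt_of_pow_lt_pow_left₀ 2 hε.le ((h t c).2.trans_lt h1)

theorem IsRieszBasis.norm_tsum_le (hφ : IsRieszBasis φ) :
    ∃ M : ℝ, 0 < M ∧ ∀ c : ℕ → ℂ, (Summable fun n => ‖c n‖ ^ 2) →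
      ‖∑' n, c n • φ n‖ ^ 2 ≤ M * ∑' n, ‖c n‖ ^ 2 := by
  obtain ⟨m, M, hm, hM, h⟩ := hφ.bounds
  refine ⟨M, hM, fun c hc => ?_⟩
  have h1 : Tendsto (fun s : Finset ℕ => ‖∑ n ∈ s, c n • φ n‖ ^ 2) atTop
      (𝓝 (‖∑' n, c n • φ n‖ ^ 2)) := ((hφ.summable_smul hc).hasSum.norm).pow 2
  exact le_of_tendsto h1 (Eventually.of_forall fun s => (h s c).2.trans
    (mul_le_mul_of_nonneg_left (hc.sum_le_tsum s fun _ _ => by positivity) hM.le))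

theorem IsRieszBasis.hasSum_coord (hφ : IsRieszBasis φ) (hψ : Biorthogonal φ ψ) (x : X) :
    HasSum (fun n => (inner ℂ (ψ n) x : ℂ) • φ n) x := by
  have h1 := hφ.summable_smul (hφ.summable_coord hψ x)
  have h2 : ∑' n, (inner ℂ (ψ n) x : ℂ) • φ n = x :=
    hφ.ext_coord hψ fun n => inner_tsum_smul hψ h1 n
  have h3 := h1.hasSum
  rwa [h2] at h3

/-- The norm of `X` is equivalent to the `ℓ²`-norm of the coordinates. -/
theorem IsRieszBasis.norm_equiv (hφ : IsRieszBasis φ) (hψ : Biorthogonal φ ψ) :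
    ∃ C : ℝ, 0 < C ∧ ∀ x : X, ‖x‖ ^ 2 ≤ C * ∑' n, ‖(inner ℂ (ψ n) x : ℂ)‖ ^ 2 ∧
      ∑' n, ‖(inner ℂ (ψ n) x : ℂ)‖ ^ 2 ≤ C * ‖x‖ ^ 2 := by
  obtain ⟨C, hC, hB⟩ := hφ.bessel hψ
  obtain ⟨M, hM, h⟩ := hφ.norm_tsum_le
  refine ⟨max C M, lt_max_of_lt_left hC, fun x => ⟨?_, ?_⟩⟩
  · have h1 := h _ (hφ.summable_coord hψ x)
    rw [(hφ.hasSum_coord hψ x).tsum_eq] at h1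
    exact h1.trans (mul_le_mul_of_nonneg_right (le_max_right _ _)
      (tsum_nonneg fun _ => by positivity))
  · exact ((hφ.summable_coord hψ x).tsum_le_of_sum_le (hB x)).trans
      (mul_le_mul_of_nonneg_right (le_max_left _ _) (by positivity))

/-- Coordinatewise domination passes to the equivalent ℓ² norms. The constant depends on the basis
alone, so bounds on multipliers become operator bounds uniformly in the spectral parameter. -/
theorem IsRieszBasis.norm_le_of_coord_le (hφ : IsRieszBasis φ) (hψ : Biorthogonal φ ψ) :
    ∃ C : ℝ, 0 < C ∧ ∀ (K : ℝ) (x y : X), 0 ≤ K →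
      (∀ n, ‖(inner ℂ (ψ n) y : ℂ)‖ ≤ K * ‖(inner ℂ (ψ n) x : ℂ)‖) → ‖y‖ ≤ C * K * ‖x‖ := by
  obtain ⟨C, hC, h⟩ := hφ.norm_equiv hψ
  refine ⟨C, hC, fun K x y hK hxy => ?_⟩
  have h1 : ∑' n, ‖(inner ℂ (ψ n) y : ℂ)‖ ^ 2 ≤ K ^ 2 * ∑' n, ‖(inner ℂ (ψ n) x : ℂ)‖ ^ 2 := by
    rw [← tsum_mul_left]
    refine (hφ.summable_coord hψ y).tsum_le_tsum (fun n => ?_)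
      ((hφ.summable_coord hψ x).mul_left _)
    rw [← mul_pow]
    exact pow_le_pow_left₀ (norm_nonneg _) (hxy n) 2
  refine le_of_sq_le_sq ?_ (by positivity)
  calc ‖y‖ ^ 2 ≤ C * ∑' n, ‖(inner ℂ (ψ n) y : ℂ)‖ ^ 2 := (h y).1
    _ ≤ C * (K ^ 2 * (C * ‖x‖ ^ 2)) := by
        refine mul_le_mul_of_nonneg_left (h1.trans ?_) hC.le
        exact mul_le_mul_of_nonneg_left (h x).2 (by positivity)
    _ = (C * K * ‖x‖) ^ 2 := by ring

/-- The diagonal operator with a given bounded sequence of multipliers. -/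
theorem IsRieszBasis.exists_diagonal (hφ : IsRieszBasis φ) (hψ : Biorthogonal φ ψ) {d : ℕ → ℂ}
    {K : ℝ} (hd : ∀ n, ‖d n‖ ≤ K) :
    ∃ D : X →L[ℂ] X, ∀ n x, (inner ℂ (ψ n) (D x) : ℂ) = d n * inner ℂ (ψ n) x := by
  obtain ⟨C, hC, h⟩ := hφ.norm_le_of_coord_le hψ
  have hK : 0 ≤ K := (norm_nonneg _).trans (hd 0)
  have hs : ∀ x, Summable fun n => (d n * (inner ℂ (ψ n) x : ℂ)) • φ n := fun x => by
    refine hφ.summable_smul (Summable.of_nonneg_of_le (fun _ => by positivity) (fun n => ?_)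
      ((hφ.summable_coord hψ x).mul_left (K ^ 2)))
    rw [norm_mul, mul_pow]
    gcongr
    exact hd n
  have hco : ∀ n x, (inner ℂ (ψ n) (∑' n, (d n * (inner ℂ (ψ n) x : ℂ)) • φ n) : ℂ) =
      d n * inner ℂ (ψ n) x := fun n x => inner_tsum_smul hψ (hs x) n
  refine ⟨LinearMap.mkContinuous
    { toFun := fun x => ∑' n, (d n * (inner ℂ (ψ n) x : ℂ)) • φ n
      map_add' := fun x y => hφ.ext_coord hψ fun n => by
        rw [inner_add_right, hco, hco, hco, inner_add_right, mul_add]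
      map_smul' := fun a x => hφ.ext_coord hψ fun n => by
        rw [RingHom.id_apply, inner_smul_right, hco, hco, inner_smul_right]
        ring } (C * K) (fun x => h K x _ hK fun n => ?_), fun n x => hco n x⟩
  · change ‖(inner ℂ (ψ n) (∑' n, (d n * (inner ℂ (ψ n) x : ℂ)) • φ n) : ℂ)‖ ≤ _
    rw [hco, norm_mul]
    gcongr
    exact hd n

/-- A functional on vectors whose coordinates are dominated by `dₙ` times those of `x`. -/
theorem IsRieszBasis.norm_functional_le (hφ : IsRieszBasis φ) (hψ : Biorthogonal φ ψ) :
    ∃ C : ℝ, 0 < C ∧ ∀ (F : X →L[ℂ] ℂ) (d : ℕ → ℝ) (x y : X),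
      (∀ n, ‖(inner ℂ (ψ n) y : ℂ)‖ ≤ d n * ‖(inner ℂ (ψ n) x : ℂ)‖) →
      (Summable fun n => ‖F (φ n)‖ ^ 2 * d n ^ 2) →
      ‖F y‖ ≤ √(C * ∑' n, ‖F (φ n)‖ ^ 2 * d n ^ 2) * ‖x‖ := by
  obtain ⟨C, hC, h⟩ := hφ.norm_equiv hψ
  refine ⟨C, hC, fun F d x y hxy hs => ?_⟩
  have h1 := (F.hasSum (hφ.hasSum_coord hψ y))
  simp only [map_smul, smul_eq_mul] at h1
  -- The absolute value is needed because Hölder's inequality asks for nonnegative sequences and no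
  -- sign is assumed on `d`.
  have hp : ∀ n, ‖(inner ℂ (ψ n) y : ℂ) * F (φ n)‖ ≤
      |‖F (φ n)‖ * d n| * ‖(inner ℂ (ψ n) x : ℂ)‖ := fun n => by
    rw [norm_mul, mul_comm]
    calc _ ≤ ‖F (φ n)‖ * (d n * ‖(inner ℂ (ψ n) x : ℂ)‖) := by gcongr; exact hxy n
      _ = ‖F (φ n)‖ * d n * ‖(inner ℂ (ψ n) x : ℂ)‖ := by ring
      _ ≤ _ := by gcongr; exact le_abs_self _
  have hs' : Summable fun n => |‖F (φ n)‖ * d n| ^ (2 : ℝ) := by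
    refine hs.congr fun n => ?_
    rw [Real.rpow_two, sq_abs, mul_pow]
  have hx' : Summable fun n => ‖(inner ℂ (ψ n) x : ℂ)‖ ^ (2 : ℝ) := by
    simpa only [Real.rpow_two] using hφ.summable_coord hψ x
  have hH := Real.summable_and_inner_le_Lp_mul_Lq_tsum_of_nonneg Real.HolderConjugate.two_two
    (fun n => abs_nonneg (‖F (φ n)‖ * d n)) (fun n => norm_nonneg (inner ℂ (ψ n) x : ℂ)) hs' hx'
  have h2 : ‖F y‖ ≤ ∑' n, |‖F (φ n)‖ * d n| * ‖(inner ℂ (ψ n) x : ℂ)‖ := by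
    rw [← h1.tsum_eq]
    exact tsum_of_norm_bounded hH.1.hasSum hp
  refine h2.trans (hH.2.trans ?_)
  simp only [Real.rpow_two, sq_abs, mul_pow, ← Real.sqrt_eq_rpow]
  rw [mul_comm C, Real.sqrt_mul (tsum_nonneg fun _ => by positivity), mul_assoc]
  gcongr
  calc √(∑' n, ‖(inner ℂ (ψ n) x : ℂ)‖ ^ 2) ≤ √(C * ‖x‖ ^ 2) := Real.sqrt_le_sqrt (h x).2
    _ = √C * ‖x‖ := by rw [Real.sqrt_mul hC.le, Real.sqrt_sq (norm_nonneg _)]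

end RieszBasis

/-! ### Orbits of a semigroup through its generator -/

section Semigroup

variable {X : Type*} [NormedAddCommGroup X]

theorem C0Semigroup.IsGenerator.hasDerivWithinAt [NormedSpace ℂ X] {T : C0Semigroup X}
    {A : X →ₗ.[ℂ] X} (hT : T.IsGenerator A) {x y : X} (h : (x, y) ∈ A.graph) {t : ℝ}
    (ht : 0 ≤ t) : HasDerivWithinAt (fun s => T s x) (T t y) (Set.Ici t) t := by
  rw [hasDerivWithinAt_iff_tendsto_slope, Set.Ici_sdiff_left]
  have h1 := (hT x y).1 h
  have h2 : Tendsto (fun s : ℝ => s - t) (𝓝[>] t) (𝓝[>] 0) := by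
    refine tendsto_nhdsWithin_iff.2 ⟨?_, ?_⟩
    · have : Tendsto (fun s : ℝ => s - t) (𝓝 t) (𝓝 (t - t)) := by
        exact (continuous_id.sub continuous_const).tendsto t
      rw [sub_self] at this
      exact this.mono_left nhdsWithin_le_nhds
    · filter_upwards [self_mem_nhdsWithin] with s hs
      exact Set.mem_Ioi.2 (sub_pos.2 (Set.mem_Ioi.1 hs))
  have h3 := ((T t).continuous.tendsto y).comp (h1.comp h2)
  refine h3.congr' ?_
  filter_upwards [self_mem_nhdsWithin] with s hs
  have hs' : 0 ≤ s - t := (sub_pos.2 hs).le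
  have e := congrArg (fun L => L x) (T.map_add' t (s - t) ht hs')
  simp only [ContinuousLinearMap.comp_apply, add_sub_cancel] at e
  simp only [Function.comp_apply, map_smul, map_sub, slope, vsub_eq_sub]
  rw [← e, ← Complex.ofReal_inv, Complex.coe_smul]

/-- The curve exp(-μs) T(s)x is continuous with zero right derivative, hence constant. -/
theorem C0Semigroup.IsGenerator.apply_eigenvector [NormedSpace ℂ X] {T : C0Semigroup X}
    {A : X →ₗ.[ℂ] X} (hT : T.IsGenerator A) {x : X} {μ : ℂ} (h : (x, μ • x) ∈ A.graph) {t : ℝ}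
    (ht : 0 ≤ t) : T t x = Complex.exp (μ * t) • x := by
  have hexp : ∀ s : ℝ, HasDerivAt (fun u : ℝ => Complex.exp (-(μ * u)))
      (Complex.exp (-(μ * s)) * (-μ)) s := by
    intro s
    have h1 : HasDerivAt (fun u : ℂ => Complex.exp (-(μ * u)))
        (Complex.exp (-(μ * s)) * (-μ)) (s : ℂ) := by
      have := ((hasDerivAt_id (s : ℂ)).const_mul μ).neg.cexp
      simpa using this
    exact h1.comp_ofReal
  have hcont : ContinuousOn (fun s : ℝ => Complex.exp (-(μ * s)) • T s x) (Set.Icc 0 t) := by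
    refine ContinuousOn.smul (by fun_prop) ((T.continuousOn' x).mono Set.Icc_subset_Ici_self)
  have hder : ∀ s ∈ Set.Ico 0 t, HasDerivWithinAt
      (fun s : ℝ => Complex.exp (-(μ * s)) • T s x) 0 (Set.Ici s) s := by
    intro s hs
    have h1 := (hexp s).hasDerivWithinAt (s := Set.Ici s) |>.smul (hT.hasDerivWithinAt h hs.1)
    refine h1.congr_deriv ?_
    rw [map_smul, smul_smul, ← add_smul]
    simp
  have h1 := constant_of_has_deriv_right_zero hcont hder t ⟨ht, le_rfl⟩
  simp only [Complex.ofReal_zero, mul_zero, neg_zero, Complex.exp_zero, one_smul] at h1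
  have h0 : T 0 x = x := by
    have := T.map_zero'
    exact congrArg (fun L => L x) this
  rw [h0] at h1
  have h2 := congrArg (fun v => Complex.exp (μ * t) • v) h1
  simp only [smul_smul, ← Complex.exp_add, add_neg_cancel, Complex.exp_zero, one_smul] at h2
  exact h2

end Semigroup

/-! ### The generator, the semigroup and the input map are diagonal -/

section Coordinates

variable {X : Type*} [NormedAddCommGroup X] [InnerProductSpace ℂ X]
  {A : X →ₗ.[ℂ] X} {lam : ℕ → ℂ} {φ ψ : ℕ → X} {T : C0Semigroup X}

theorem IsRieszSpectral.eigenvector_mem_graph (hA : IsRieszSpectral A lam φ) (n : ℕ) :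
    (φ n, lam n • φ n) ∈ A.graph :=
  (hA.eigenspace n _).2 (Submodule.mem_span_singleton_self _)

variable [CompleteSpace X]

theorem IsRieszSpectral.coord_semigroup (hA : IsRieszSpectral A lam φ) (hψ : Biorthogonal φ ψ)
    (hT : T.IsGenerator A) {t : ℝ} (ht : 0 ≤ t) (n : ℕ) (x : X) :
    (inner ℂ (ψ n) (T t x) : ℂ) = Complex.exp (lam n * t) * inner ℂ (ψ n) x := by
  have h1 := (innerSL ℂ (ψ n)).hasSum ((T t).hasSum (hA.rieszBasis.hasSum_coord hψ x))
  have h2 : HasSum (fun k => innerSL ℂ (ψ n) (T t ((inner ℂ (ψ k) x : ℂ) • φ k)))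
      (Complex.exp (lam n * t) * inner ℂ (ψ n) x) := by
    convert hasSum_single n ?_ using 1
    · simp [hT.apply_eigenvector (hA.eigenvector_mem_graph n) ht, hψ n n, mul_comm]
    · intro k hk
      simp [hT.apply_eigenvector (hA.eigenvector_mem_graph k) ht, hψ k n, hk]
  simpa using h1.unique h2

/-- `A` is the diagonal operator with maximal domain. -/
theorem IsRieszSpectral.mem_graph_iff (hA : IsRieszSpectral A lam φ) (hψ : Biorthogonal φ ψ)
    (hT : T.IsGenerator A) (x y : X) :
    (x, y) ∈ A.graph ↔ ∀ n, (inner ℂ (ψ n) y : ℂ) = lam n * inner ℂ (ψ n) x := by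
  constructor
  · intro h n
    have h1 := ((innerSL ℂ (ψ n)).continuous.tendsto y).comp ((hT x y).1 h)
    have h2 : HasDerivAt (fun s : ℝ => Complex.exp (lam n * s)) (lam n) 0 := by
      have h3 : HasDerivAt (fun u : ℂ => Complex.exp (lam n * u)) (lam n) ((0 : ℝ) : ℂ) := by
        have := ((hasDerivAt_id ((0 : ℝ) : ℂ)).const_mul (lam n)).cexp
        simpa using this
      exact h3.comp_ofReal
    have h4 := hasDerivWithinAt_iff_tendsto_slope.1 (h2.hasDerivWithinAt (s := Set.Ioi 0))
    have h5 := h4.mul_const (inner ℂ (ψ n) x : ℂ)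
    rw [Set.sdiff_singleton_eq_self (by simp)] at h5
    refine tendsto_nhds_unique h1 (h5.congr' ?_)
    filter_upwards [self_mem_nhdsWithin] with s hs
    have hs' : (0 : ℝ) ≤ s := le_of_lt hs
    rw [Function.comp_apply, innerSL_apply_apply, inner_smul_right, inner_sub_right,
      hA.coord_semigroup hψ hT hs']
    simp [slope]
    ring
  -- Partial sums of the two expansions are combinations of the pairs (φₙ, λₙφₙ), so they lie in the
  -- graph; closedness of `A` carries this to the limit.
  · intro h
    have hx := hA.rieszBasis.hasSum_coord hψ x
    have hy := hA.rieszBasis.hasSum_coord hψ y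
    have hxy : Tendsto (fun s : Finset ℕ => (∑ n ∈ s, (inner ℂ (ψ n) x : ℂ) • φ n,
        ∑ n ∈ s, (inner ℂ (ψ n) y : ℂ) • φ n)) atTop (𝓝 (x, y)) := hx.prodMk_nhds hy
    refine hA.closed.mem_of_tendsto hxy (Eventually.of_forall fun s => ?_)
    have h1 : (∑ n ∈ s, (inner ℂ (ψ n) x : ℂ) • φ n, ∑ n ∈ s, (inner ℂ (ψ n) y : ℂ) • φ n) =
        ∑ n ∈ s, (inner ℂ (ψ n) x : ℂ) • (φ n, lam n • φ n) := by
      refine Prod.ext ?_ ?_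
      · simp [Prod.fst_sum]
      · simp only [Prod.snd_sum, Prod.smul_snd, smul_smul]
        exact Finset.sum_congr rfl fun n _ => by rw [h n, mul_comm]
    rw [h1]
    exact Submodule.sum_mem _ fun n _ => Submodule.smul_mem _ _ (hA.eigenvector_mem_graph n)

theorem IsRieszSpectral.coord_inputMap (hA : IsRieszSpectral A lam φ) (hψ : Biorthogonal φ ψ)
    (hT : T.IsGenerator A) {b : X} {B : ℂ →L[ℂ] X} (hB : ∀ u : ℂ, B u = u • b) {τ : ℝ}
    (hτ : 0 ≤ τ) (n : ℕ) (u : ℂ) :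
    (inner ℂ (ψ n) (inputMap T B τ u) : ℂ) =
      (∫ s in (0 : ℝ)..τ, Complex.exp (lam n * s)) * inner ℂ (ψ n) b * u := by
  rw [inputMap_apply]
  have hi : IntervalIntegrable (fun s => T s (B u)) volume 0 τ :=
    ((T.continuousOn' (B u)).mono (by rw [Set.uIcc_of_le hτ]; exact
      Set.Icc_subset_Ici_self)).intervalIntegrable
  have h1 := (innerSL ℂ (ψ n)).intervalIntegral_comp_comm hi
  simp only [innerSL_apply_apply] at h1
  rw [← h1, ← intervalIntegral.integral_mul_const, ← intervalIntegral.integral_mul_const]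
  refine intervalIntegral.integral_congr fun s hs => ?_
  rw [Set.uIcc_of_le hτ] at hs
  rw [hA.coord_semigroup hψ hT hs.1, hB, inner_smul_right]
  ring

end Coordinates

/-! ### Diagonal operators on coordinate subspaces -/

section CoordSubspace

variable {X : Type*} [NormedAddCommGroup X] [InnerProductSpace ℂ X]
  {E : Type*} [NormedAddCommGroup E] [NormedSpace ℂ E]

/-- `E` is isometrically identified with the space of all `x` whose coordinates outside of `N`
vanish. -/
def IsCoordSubspace (ψ : ℕ → X) (ι : E →ₗᵢ[ℂ] X) (N : Set ℕ) : Prop :=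
  ∀ x : X, x ∈ Set.range ι ↔ ∀ n ∉ N, (inner ℂ (ψ n) x : ℂ) = 0

/-- `L` acts on `E` by multiplying the coordinates by `d`. -/
def HasMultipliers (ψ : ℕ → X) (ι : E →ₗᵢ[ℂ] X) (d : ℕ → ℂ) (L : E →L[ℂ] E) : Prop :=
  ∀ n x, (inner ℂ (ψ n) (ι (L x)) : ℂ) = d n * inner ℂ (ψ n) (ι x)

/-- The operator `A` on `E` is the diagonal operator with eigenvalues `lam n`, with maximal
domain. -/
def IsDiagonalOp (ψ : ℕ → X) (ι : E →ₗᵢ[ℂ] X) (lam : ℕ → ℂ) (A : E →ₗ.[ℂ] E) : Prop :=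
  ∀ x y, (x, y) ∈ A.graph ↔
    ∀ n, (inner ℂ (ψ n) (ι y) : ℂ) = lam n * inner ℂ (ψ n) (ι x)

theorem isResolventAt_opResolvent {A : E →ₗ.[ℂ] E} {z : ℂ} (h : z ∈ opResolventSet A) :
    IsResolventAt A z (opResolvent A z) := by
  have h' : ∃ R : E →L[ℂ] E, IsResolventAt A z R := h
  unfold opResolvent
  rw [dif_pos h']
  exact h'.choose_spec

variable {φ ψ : ℕ → X} {ι : E →ₗᵢ[ℂ] X} {N : Set ℕ}

theorem IsCoordSubspace.coord_eq_zero (hι : IsCoordSubspace ψ ι N) (x : E) {n : ℕ} (hn : n ∉ N) :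
    (inner ℂ (ψ n) (ι x) : ℂ) = 0 := (hι (ι x)).1 ⟨x, rfl⟩ n hn

theorem IsCoordSubspace.ext_coord (hφ : IsRieszBasis φ) (hψ : Biorthogonal φ ψ)
    (hι : IsCoordSubspace ψ ι N) {x y : E}
    (h : ∀ n ∈ N, (inner ℂ (ψ n) (ι x) : ℂ) = inner ℂ (ψ n) (ι y)) : x = y := by
  refine ι.injective (hφ.ext_coord hψ fun n => ?_)
  by_cases hn : n ∈ N
  · exact h n hn
  · rw [hι.coord_eq_zero x hn, hι.coord_eq_zero y hn]

/-- The range is an intersection of kernels of continuous functionals, hence closed. Completeness is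
needed for the operator-valued integral in the fractional power. -/
theorem IsCoordSubspace.completeSpace [CompleteSpace X] (hι : IsCoordSubspace ψ ι N) :
    CompleteSpace E := by
  have h1 : IsClosed (Set.range ι) := by
    have h2 : Set.range ι = ⋂ n ∈ Nᶜ, {x : X | (inner ℂ (ψ n) x : ℂ) = 0} := by
      ext x
      rw [hι x]
      simp
    rw [h2]
    exact isClosed_biInter fun n _ => isClosed_eq (by fun_prop) continuous_const
  exact (completeSpace_iff_isComplete_range ι.isometry.isUniformInducing).2 h1.isComplete

variable {lam : ℕ → ℂ} {A : E →ₗ.[ℂ] E}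

theorem IsDiagonalOp.coord_opResolvent (hA : IsDiagonalOp ψ ι lam A) {z : ℂ}
    (hz : z ∈ opResolventSet A) (n : ℕ) (x : E) :
    (z - lam n) * (inner ℂ (ψ n) (ι (opResolvent A z x)) : ℂ) = inner ℂ (ψ n) (ι x) := by
  have h1 := ((isResolventAt_opResolvent hz) x _).1 rfl
  rw [hA] at h1
  have h2 := h1 n
  simp only [map_sub, map_smul, inner_sub_right, inner_smul_right] at h2
  linear_combination h2

theorem IsDiagonalOp.coord_opResolvent' (hι : IsCoordSubspace ψ ι N) (hA : IsDiagonalOp ψ ι lam A)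
    {z : ℂ} (hz : z ∈ opResolventSet A) (hne : ∀ n ∈ N, z - lam n ≠ 0) (n : ℕ) (x : E) :
    (inner ℂ (ψ n) (ι (opResolvent A z x)) : ℂ) = (z - lam n)⁻¹ * inner ℂ (ψ n) (ι x) := by
  by_cases hn : n ∈ N
  · rw [← hA.coord_opResolvent hz n x, inv_mul_cancel_left₀ (hne n hn)]
  · rw [hι.coord_eq_zero _ hn, hι.coord_eq_zero _ hn, mul_zero]

variable [CompleteSpace X]

/-- Extending `d` by 0 outside `N` gives a bounded diagonal operator of the whole space, and its
values have vanishing coordinates outside `N`. -/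
theorem IsCoordSubspace.exists_multipliers (hφ : IsRieszBasis φ) (hψ : Biorthogonal φ ψ)
    (hι : IsCoordSubspace ψ ι N) {d : ℕ → ℂ} {K : ℝ} (hK : 0 ≤ K) (hd : ∀ n ∈ N, ‖d n‖ ≤ K) :
    ∃ D : E →L[ℂ] E, HasMultipliers ψ ι d D := by
  classical
  obtain ⟨D, hD⟩ := hφ.exists_diagonal hψ (d := fun n => if n ∈ N then d n else 0) (K := K) (by
    intro n
    split_ifs with h
    · exact hd n h
    · simpa using hK)
  have hm : ∀ x, D (ι x) ∈ LinearMap.range ι.toLinearMap := by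
    intro x
    have : D (ι x) ∈ Set.range ι := (hι _).2 fun n hn => by simp [hD, hn]
    simpa using this
  refine ⟨(ι.equivRange.symm.toContinuousLinearEquiv : _ →L[ℂ] E) ∘L
    (D ∘L ι.toContinuousLinearMap).codRestrict _ hm, fun n x => ?_⟩
  have h1 : ι (ι.equivRange.symm ⟨D (ι x), hm x⟩) = D (ι x) := by
    have := ι.equivRange.apply_symm_apply ⟨D (ι x), hm x⟩
    exact congrArg Subtype.val this
  change (inner ℂ (ψ n) (ι (ι.equivRange.symm ⟨D (ι x), hm x⟩)) : ℂ) = _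
  rw [h1, hD]
  split_ifs with hn
  · rfl
  · rw [hι.coord_eq_zero x hn, mul_zero, mul_zero]

theorem exists_opNorm_le_of_coord (hφ : IsRieszBasis φ) (hψ : Biorthogonal φ ψ) :
    ∃ C : ℝ, 0 < C ∧ ∀ (K : ℝ) (L : E →L[ℂ] E), 0 ≤ K →
      (∀ n x, ‖(inner ℂ (ψ n) (ι (L x)) : ℂ)‖ ≤ K * ‖(inner ℂ (ψ n) (ι x) : ℂ)‖) →
      ‖L‖ ≤ C * K := by
  obtain ⟨C, hC, h⟩ := hφ.norm_le_of_coord_le hψ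
  refine ⟨C, hC, fun K L hK hL => L.opNorm_le_bound (by positivity) fun x => ?_⟩
  have := h K (ι x) (ι (L x)) hK fun n => hL n x
  simpa using this

/-- The resolvent of a bounded diagonal operator. -/
theorem HasMultipliers.resolvent (hφ : IsRieszBasis φ) (hψ : Biorthogonal φ ψ)
    (hι : IsCoordSubspace ψ ι N) {p : ℕ → ℂ} {L : E →L[ℂ] E} (hL : HasMultipliers ψ ι p L) {z : ℂ}
    {c : ℝ} (hc : 0 < c) (hz : ∀ n ∈ N, c ≤ ‖z - p n‖) :
    z ∈ resolventSet ℂ L ∧ ∀ n ∈ N, ∀ x,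
      (inner ℂ (ψ n) (ι (resolvent L z x)) : ℂ) = (z - p n)⁻¹ * inner ℂ (ψ n) (ι x) := by
  have hne : ∀ n ∈ N, z - p n ≠ 0 := fun n hn => norm_pos_iff.1 (hc.trans_le (hz n hn))
  obtain ⟨D, hD⟩ := hι.exists_multipliers hφ hψ (d := fun n => (z - p n)⁻¹) (K := c⁻¹)
    (by positivity) (fun n hn => by rw [norm_inv]; exact inv_anti₀ hc (hz n hn))
  have h1 : (algebraMap ℂ (E →L[ℂ] E) z - L) * D = 1 := by
    ext x
    refine hι.ext_coord hφ hψ fun n hn => ?_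
    simp [Algebra.algebraMap_eq_smul_one, hL n, hD n]
    field_simp [hne n hn]
  have h2 : D * (algebraMap ℂ (E →L[ℂ] E) z - L) = 1 := by
    ext x
    refine hι.ext_coord hφ hψ fun n hn => ?_
    simp [Algebra.algebraMap_eq_smul_one, hL n, hD n]
    field_simp [hne n hn]
  have h3 : _root_.resolvent L z = D := by
    have := Ring.inverse_unit (⟨_, D, h1, h2⟩ : (E →L[ℂ] E)ˣ)
    simpa [_root_.resolvent] using this
  refine ⟨⟨⟨_, D, h1, h2⟩, rfl⟩, fun n _ x => ?_⟩
  rw [h3, hD]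

theorem IsDiagonalOp.mem_opResolventSet (hφ : IsRieszBasis φ) (hψ : Biorthogonal φ ψ)
    (hι : IsCoordSubspace ψ ι N) (hA : IsDiagonalOp ψ ι lam A) {z : ℂ} {c : ℝ} (hc : 0 < c)
    (hz : ∀ n ∈ N, c ≤ ‖z - lam n‖) : z ∈ opResolventSet A := by
  have hne : ∀ n ∈ N, z - lam n ≠ 0 := fun n hn => norm_pos_iff.1 (hc.trans_le (hz n hn))
  obtain ⟨D, hD⟩ := hι.exists_multipliers hφ hψ (d := fun n => (z - lam n)⁻¹) (K := c⁻¹)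
    (by positivity) (fun n hn => by rw [norm_inv]; exact inv_anti₀ hc (hz n hn))
  refine ⟨D, fun x y => ?_⟩
  rw [hA]
  constructor
  · rintro rfl n
    by_cases hn : n ∈ N
    · simp only [map_sub, map_smul, inner_sub_right, inner_smul_right, hD n x]
      field_simp [hne n hn]
      ring
    · rw [hι.coord_eq_zero _ hn, hι.coord_eq_zero _ hn, mul_zero]
  · intro h
    refine hι.ext_coord hφ hψ fun n hn => ?_
    have h1 := h n
    simp only [map_sub, map_smul, inner_sub_right, inner_smul_right] at h1
    rw [hD n x, inv_mul_eq_iff_eq_mul₀ (hne n hn)]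
    linear_combination -h1

/-- Norm bound and Lipschitz bound for the resolvent of a diagonal operator. -/
theorem IsDiagonalOp.exists_opResolvent_bound (hφ : IsRieszBasis φ) (hψ : Biorthogonal φ ψ)
    (hι : IsCoordSubspace ψ ι N) (hA : IsDiagonalOp ψ ι lam A) :
    ∃ C : ℝ, 0 < C ∧ ∀ c : ℝ, 0 < c → ∀ z : ℂ, (∀ n ∈ N, c ≤ ‖z - lam n‖) →
      ‖opResolvent A z‖ ≤ C * c⁻¹ ∧ ∀ w : ℂ, (∀ n ∈ N, c ≤ ‖w - lam n‖) →
        ‖opResolvent A w - opResolvent A z‖ ≤ C * (c⁻¹ ^ 2 * ‖w - z‖) := by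
  obtain ⟨C, hC, h⟩ := exists_opNorm_le_of_coord (ι := ι) hφ hψ
  refine ⟨C, hC, fun c hc z hz => ?_⟩
  have hne : ∀ z : ℂ, (∀ n ∈ N, c ≤ ‖z - lam n‖) → ∀ n ∈ N, z - lam n ≠ 0 :=
    fun z hz n hn => norm_pos_iff.1 (hc.trans_le (hz n hn))
  have hco : ∀ z : ℂ, (∀ n ∈ N, c ≤ ‖z - lam n‖) → ∀ n x,
      (inner ℂ (ψ n) (ι (opResolvent A z x)) : ℂ) = (z - lam n)⁻¹ * inner ℂ (ψ n) (ι x) :=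
    fun z hz n x => hA.coord_opResolvent' hι (hA.mem_opResolventSet hφ hψ hι hc hz) (hne z hz) n x
  have hin : ∀ z : ℂ, (∀ n ∈ N, c ≤ ‖z - lam n‖) → ∀ n ∈ N, ‖(z - lam n)⁻¹‖ ≤ c⁻¹ :=
    fun z hz n hn => by rw [norm_inv]; exact inv_anti₀ hc (hz n hn)
  refine ⟨h _ _ (by positivity) fun n x => ?_, fun w hw => h _ _ (by positivity) fun n x => ?_⟩
  · by_cases hn : n ∈ N
    · rw [hco z hz, norm_mul]
      gcongr
      exact hin z hz n hn
    · rw [hι.coord_eq_zero _ hn, hι.coord_eq_zero _ hn]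
      simp
  · by_cases hn : n ∈ N
    · rw [sub_apply, map_sub, inner_sub_right, hco z hz, hco w hw, ← sub_mul,
        norm_mul]
      gcongr
      have e : (w - lam n)⁻¹ - (z - lam n)⁻¹ = (w - lam n)⁻¹ * (z - lam n)⁻¹ * (z - w) := by
        have h1 := hne z hz n hn
        have h2 := hne w hw n hn
        field_simp
        ring
      rw [e, norm_mul, norm_mul, norm_sub_rev z w, sq]
      gcongr
      · exact hin w hw n hn
      · exact hin z hz n hn
    · rw [hι.coord_eq_zero _ hn, hι.coord_eq_zero _ hn]
      simp

/-- Within distance c/2 of z half of the gap survives, so the Lipschitz bound holds there with one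
constant. -/
theorem IsDiagonalOp.continuousAt_opResolvent (hφ : IsRieszBasis φ) (hψ : Biorthogonal φ ψ)
    (hι : IsCoordSubspace ψ ι N) (hA : IsDiagonalOp ψ ι lam A) {z : ℂ} {c : ℝ} (hc : 0 < c)
    (hz : ∀ n ∈ N, c ≤ ‖z - lam n‖) : ContinuousAt (opResolvent A) z := by
  obtain ⟨C, hC, h⟩ := hA.exists_opResolvent_bound hφ hψ hι
  have hz2 : ∀ n ∈ N, c / 2 ≤ ‖z - lam n‖ := fun n hn => by linarith [hz n hn]
  refine continuousAt_of_locally_lipschitz (r := c / 2) (by positivity)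
    (C * (c / 2)⁻¹ ^ 2) fun w hw => ?_
  rw [dist_eq_norm] at hw
  rw [dist_eq_norm, dist_eq_norm, mul_assoc]
  refine ((h (c / 2) (by positivity) z hz2).2 w fun n hn => ?_)
  have h1 : z - lam n = (w - lam n) - (w - z) := by ring
  have h2 := norm_sub_le (w - lam n) (w - z)
  rw [← h1] at h2
  linarith [hz n hn]

end CoordSubspace

/-! ### The spectral projection and its two ranges -/

section SpectralProjection

variable {X : Type*} [NormedAddCommGroup X] [InnerProductSpace ℂ X]
  {A : X →ₗ.[ℂ] X} {lam : ℕ → ℂ} {φ ψ : ℕ → X} {T : C0Semigroup X} {Φ : ℝ → ℂ}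

/-- The resolvent has φₙ as eigenvector with eigenvalue (z - λₙ)⁻¹, so ‖R‖ bounds all of these
numbers. The added 1 only keeps the inverse positive. -/
theorem IsRieszSpectral.exists_gap (hA : IsRieszSpectral A lam φ) (hψ : Biorthogonal φ ψ)
    {z : ℂ} (hz : z ∈ opResolventSet A) : ∃ c : ℝ, 0 < c ∧ ∀ n, c ≤ ‖z - lam n‖ := by
  obtain ⟨R, hR⟩ := hz
  have hφ0 : ∀ n, φ n ≠ 0 := fun n h => by simpa [h] using hψ n n
  refine ⟨(‖R‖ + 1)⁻¹, by positivity, fun n => ?_⟩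
  have hne : z - lam n ≠ 0 := by
    intro h
    have h1 : R 0 = φ n := by
      rw [hR, sub_eq_zero.1 h, sub_zero]
      exact hA.eigenvector_mem_graph n
    rw [map_zero] at h1
    exact hφ0 n h1.symm
  have h1 : R (φ n) = (z - lam n)⁻¹ • φ n := by
    rw [hR]
    have h2 := A.graph.smul_mem (z - lam n)⁻¹ (hA.eigenvector_mem_graph n)
    convert h2 using 1
    refine Prod.ext rfl ?_
    simp only [Prod.smul_snd, smul_smul]
    nth_rewrite 2 [← one_smul ℂ (φ n)]
    rw [← sub_smul]
    congr 1
    field_simp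
    ring
  have h2 := R.le_opNorm (φ n)
  rw [h1, norm_smul, norm_inv] at h2
  have h3 := le_of_mul_le_mul_right h2 (norm_pos_iff.2 (hφ0 n))
  rw [inv_le_comm₀ (by positivity) (norm_pos_iff.2 hne)]
  linarith

theorem IsRieszSpectral.mem_opSpectrum (hA : IsRieszSpectral A lam φ) (hψ : Biorthogonal φ ψ)
    (n : ℕ) : lam n ∈ opSpectrum A := by
  intro h
  obtain ⟨c, hc, h1⟩ := hA.exists_gap hψ h
  have := h1 n
  simp only [sub_self, norm_zero] at this
  linarith

theorem isCoordSubspace_id : IsCoordSubspace ψ (LinearIsometry.id : X →ₗᵢ[ℂ] X) Set.univ :=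
  fun x => by simp

variable [CompleteSpace X]

theorem IsRieszSpectral.isDiagonalOp (hA : IsRieszSpectral A lam φ) (hψ : Biorthogonal φ ψ)
    (hT : T.IsGenerator A) : IsDiagonalOp ψ (LinearIsometry.id : X →ₗᵢ[ℂ] X) lam A :=
  hA.mem_graph_iff hψ hT

/-- A coordinate functional may be taken under the contour integral because the resolvent is
continuous along the curve; what remains is the winding integral of (Φ(t) - λₙ)⁻¹. -/
theorem IsRieszSpectral.coord_spectralProj (hA : IsRieszSpectral A lam φ)
    (hψ : Biorthogonal φ ψ) (hT : T.IsGenerator A) (hΦ : IsSeparatingContour A Φ) (n : ℕ) (x : X) :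
    (inner ℂ (ψ n) (spectralProj A Φ x) : ℂ) = windingNumber Φ (lam n) * inner ℂ (ψ n) x := by
  have hc : Continuous fun t => deriv Φ t • opResolvent A (Φ t) := by
    refine (hΦ.smooth.continuous_deriv (by simp)).smul ?_
    rw [continuous_iff_continuousAt]
    intro t
    obtain ⟨c, hc, h⟩ := hA.exists_gap hψ (hΦ.mem_resolventSet t)
    exact ((hA.isDiagonalOp hψ hT).continuousAt_opResolvent hA.rieszBasis hψ isCoordSubspace_id hc
      fun n _ => h n).comp hΦ.smooth.continuous.continuousAt
  have h1 := ((innerSL ℂ (ψ n)).comp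
    (ContinuousLinearMap.apply ℂ X x : (X →L[ℂ] X) →L[ℂ] X)).intervalIntegral_comp_comm
    (hc.intervalIntegrable (μ := volume) 0 (2 * Real.pi))
  simp only [ContinuousLinearMap.comp_apply, innerSL_apply_apply,
    ContinuousLinearMap.apply_apply] at h1
  unfold spectralProj windingNumber
  rw [smul_apply, inner_smul_right, ← h1, mul_assoc _ _ (inner ℂ (ψ n) x : ℂ),
    ← intervalIntegral.integral_mul_const]
  congr 1
  refine intervalIntegral.integral_congr fun t _ => ?_
  obtain ⟨c, hc, h⟩ := hA.exists_gap hψ (hΦ.mem_resolventSet t)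
  have h2 := (hA.isDiagonalOp hψ hT).coord_opResolvent' isCoordSubspace_id
    (hΦ.mem_resolventSet t) (fun n _ => norm_pos_iff.1 (hc.trans_le (h n))) n x
  simp only [LinearIsometry.id_apply] at h2
  simp only [smul_apply, inner_smul_right, h2]
  ring

theorem IsRieszSpectral.coord_spectralProj_of_pos (hA : IsRieszSpectral A lam φ)
    (hψ : Biorthogonal φ ψ) (hT : T.IsGenerator A) (hΦ : IsSeparatingContour A Φ) {n : ℕ}
    (hn : 0 < (lam n).re) (x : X) :
    (inner ℂ (ψ n) (spectralProj A Φ x) : ℂ) = inner ℂ (ψ n) x := by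
  rw [hA.coord_spectralProj hψ hT hΦ, hΦ.interior _ (hA.mem_opSpectrum hψ n) hn, one_mul]

theorem IsRieszSpectral.coord_spectralProj_of_nonpos (hA : IsRieszSpectral A lam φ)
    (hψ : Biorthogonal φ ψ) (hT : T.IsGenerator A) (hΦ : IsSeparatingContour A Φ) {n : ℕ}
    (hn : (lam n).re ≤ 0) (x : X) :
    (inner ℂ (ψ n) (spectralProj A Φ x) : ℂ) = 0 := by
  rw [hA.coord_spectralProj hψ hT hΦ, hΦ.exterior _ (hA.mem_opSpectrum hψ n) hn, zero_mul]

theorem IsRieszSpectral.isCoordSubspace_plusSpace (hA : IsRieszSpectral A lam φ)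
    (hψ : Biorthogonal φ ψ) (hT : T.IsGenerator A) (hΦ : IsSeparatingContour A Φ) :
    IsCoordSubspace ψ (plusSpace A Φ).subtypeₗᵢ {n | 0 < (lam n).re} := by
  intro x
  rw [Submodule.coe_subtypeₗᵢ, Submodule.coe_subtype, Subtype.range_coe]
  constructor
  · rintro ⟨y, rfl⟩ n hn
    exact hA.coord_spectralProj_of_nonpos hψ hT hΦ (not_lt.1 hn) y
  · intro h
    refine ⟨x, hA.rieszBasis.ext_coord hψ fun n => ?_⟩
    rcases lt_or_ge 0 (lam n).re with hn | hn
    · exact hA.coord_spectralProj_of_pos hψ hT hΦ hn x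
    · rw [h n (not_lt.2 hn)]
      exact hA.coord_spectralProj_of_nonpos hψ hT hΦ hn x

theorem IsRieszSpectral.isCoordSubspace_minusSpace (hA : IsRieszSpectral A lam φ)
    (hψ : Biorthogonal φ ψ) (hT : T.IsGenerator A) (hΦ : IsSeparatingContour A Φ) :
    IsCoordSubspace ψ (minusSpace A Φ).subtypeₗᵢ {n | (lam n).re ≤ 0} := by
  intro x
  rw [Submodule.coe_subtypeₗᵢ, Submodule.coe_subtype, Subtype.range_coe]
  have e : ∀ y, (ContinuousLinearMap.id ℂ X - spectralProj A Φ).toLinearMap y =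
    y - spectralProj A Φ y := fun y => rfl
  constructor
  · rintro ⟨y, rfl⟩ n hn
    rw [e, inner_sub_right, hA.coord_spectralProj_of_pos hψ hT hΦ (not_le.1 hn), sub_self]
  · intro h
    refine ⟨x, hA.rieszBasis.ext_coord hψ fun n => ?_⟩
    rw [e, inner_sub_right]
    rcases lt_or_ge 0 (lam n).re with hn | hn
    · rw [hA.coord_spectralProj_of_pos hψ hT hΦ hn, h n (not_le.2 hn), sub_self]
    · rw [hA.coord_spectralProj_of_nonpos hψ hT hΦ hn, sub_zero]

theorem IsRieszSpectral.isDiagonalOp_opMinus (hA : IsRieszSpectral A lam φ)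
    (hψ : Biorthogonal φ ψ) (hT : T.IsGenerator A) :
    IsDiagonalOp ψ (minusSpace A Φ).subtypeₗᵢ lam (opMinus A Φ) := fun x y => by
  rw [opMinus, mem_graph_opPart]
  exact hA.mem_graph_iff hψ hT x y

theorem IsRieszSpectral.hasMultipliers_semigroup (hA : IsRieszSpectral A lam φ)
    (hψ : Biorthogonal φ ψ) (hT : T.IsGenerator A) {t : ℝ} (ht : 0 ≤ t) :
    HasMultipliers ψ (LinearIsometry.id : X →ₗᵢ[ℂ] X) (fun n => Complex.exp (lam n * t)) (T t) :=
  fun n x => hA.coord_semigroup hψ hT ht n x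

theorem IsRieszSpectral.hasMultipliers_semigroupPlus (hA : IsRieszSpectral A lam φ)
    (hψ : Biorthogonal φ ψ) (hT : T.IsGenerator A) {t : ℝ} (ht : 0 ≤ t) :
    HasMultipliers ψ (plusSpace A Φ).subtypeₗᵢ (fun n => Complex.exp (lam n * t))
      (semigroupPlus hT ht Φ) :=
  fun n x => hA.coord_semigroup hψ hT ht n x

theorem IsRieszSpectral.hasMultipliers_semigroupMinus (hA : IsRieszSpectral A lam φ)
    (hψ : Biorthogonal φ ψ) (hT : T.IsGenerator A) {t : ℝ} (ht : 0 ≤ t) :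
    HasMultipliers ψ (minusSpace A Φ).subtypeₗᵢ (fun n => Complex.exp (lam n * t))
      (semigroupMinus hT ht Φ) :=
  fun n x => hA.coord_semigroup hψ hT ht n x

end SpectralProjection

/-! ### Multipliers of the negative fractional power -/

section FractionalPower

/-- Majorant for Balakrishnan's integral, computed by splitting at t = a; the scaling a^{-s} is the
decay wanted for the multiplier. -/
theorem integrableOn_rpow_mul_inv_max {s a : ℝ} (hs0 : 0 < s) (hs1 : s < 1) (ha : 0 < a) :
    IntegrableOn (fun t : ℝ => t ^ (-s) * (max t a)⁻¹) (Set.Ioi 0) ∧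
      ∫ t in Set.Ioi (0 : ℝ), t ^ (-s) * (max t a)⁻¹ = ((1 - s)⁻¹ + s⁻¹) * a ^ (-s) := by
  have e1 : Set.EqOn (fun t : ℝ => t ^ (-s) * a⁻¹) (fun t : ℝ => t ^ (-s) * (max t a)⁻¹)
      (Set.Ioc 0 a) := fun t ht => by simp only; rw [max_eq_right ht.2]
  have e2 : Set.EqOn (fun t : ℝ => t ^ (-s - 1)) (fun t : ℝ => t ^ (-s) * (max t a)⁻¹)
      (Set.Ioi a) := fun t ht => by
    have ht' : a < t := ht
    simp only
    rw [max_eq_left ht'.le, Real.rpow_sub_one (ha.trans ht').ne', div_eq_mul_inv]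
  have i1 : IntegrableOn (fun t : ℝ => t ^ (-s) * a⁻¹) (Set.Ioc 0 a) := by
    have := (intervalIntegral.intervalIntegrable_rpow' (a := 0) (b := a) (r := -s)
      (by linarith)).mul_const a⁻¹
    rwa [intervalIntegrable_iff_integrableOn_Ioc_of_le ha.le] at this
  have i2 : IntegrableOn (fun t : ℝ => t ^ (-s - 1)) (Set.Ioi a) :=
    integrableOn_Ioi_rpow_of_lt (by linarith) ha
  have j1 := i1.congr_fun e1 measurableSet_Ioc
  have j2 := i2.congr_fun e2 measurableSet_Ioi
  rw [← Set.Ioc_union_Ioi_eq_Ioi ha.le]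
  refine ⟨j1.union j2, ?_⟩
  rw [setIntegral_union (Set.Ioc_disjoint_Ioi le_rfl) measurableSet_Ioi j1 j2,
    ← setIntegral_congr_fun measurableSet_Ioc e1, ← setIntegral_congr_fun measurableSet_Ioi e2,
    integral_Ioi_rpow_of_lt (by linarith) ha, ← intervalIntegral.integral_of_le ha.le,
    intervalIntegral.integral_mul_const, integral_rpow (Or.inl (by linarith)),
    Real.zero_rpow (by linarith), Real.rpow_add_one ha.ne']
  have h1 : 1 - s ≠ 0 := by linarith
  have h2 : -s + 1 ≠ 0 := by linarith
  have h3 : -s - 1 + 1 = -s := by ring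
  rw [h3]
  field_simp
  ring

/-- For t ≥ 0 and Re z ≤ 0, subtracting z from t produces no cancellation: |t - z|² exceeds |z|² by
t(t - 2 Re z) ≥ 0. -/
theorem max_le_norm_ofReal_sub {t : ℝ} (ht : 0 ≤ t) {z : ℂ} (hz : z.re ≤ 0) :
    max t ‖z‖ ≤ ‖(t : ℂ) - z‖ := by
  refine max_le ?_ ?_
  · have h1 := Complex.re_le_norm ((t : ℂ) - z)
    simp only [Complex.sub_re, Complex.ofReal_re] at h1
    linarith
  · refine le_of_sq_le_sq ?_ (norm_nonneg _)
    rw [Complex.sq_norm, Complex.sq_norm, Complex.normSq_apply, Complex.normSq_apply]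
    simp only [Complex.sub_re, Complex.ofReal_re, Complex.sub_im, Complex.ofReal_im]
    nlinarith

variable {X : Type*} [NormedAddCommGroup X] [InnerProductSpace ℂ X] [CompleteSpace X]
  {E : Type*} [NormedAddCommGroup E] [NormedSpace ℂ E]
  {φ ψ : ℕ → X} {ι : E →ₗᵢ[ℂ] X} {N : Set ℕ} {lam : ℕ → ℂ} {A : E →ₗ.[ℂ] E}

/-- The multipliers of `(-A)^{-δ}` are bounded by multiples of `|λₙ|^{-δ}`. -/
theorem IsDiagonalOp.coord_negFracPow_le (hφ : IsRieszBasis φ) (hψ : Biorthogonal φ ψ)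
    (hι : IsCoordSubspace ψ ι N) (hA : IsDiagonalOp ψ ι lam A) {c : ℝ} (hc : 0 < c)
    (hre : ∀ n ∈ N, (lam n).re ≤ 0) (hlam : ∀ n ∈ N, c ≤ ‖lam n‖) {δ : ℝ} (hδ : 0 ≤ δ) :
    ∃ C : ℝ, 0 < C ∧ ∀ n ∈ N, ∀ x, ‖(inner ℂ (ψ n) (ι (negFracPow A δ x)) : ℂ)‖ ≤
      C * ‖lam n‖ ^ (-δ) * ‖(inner ℂ (ψ n) (ι x) : ℂ)‖ := by
  have hcomp := hι.completeSpace
  have hlow : ∀ t : ℝ, 0 ≤ t → ∀ n ∈ N, max t c ≤ ‖(t : ℂ) - lam n‖ := fun t ht n hn =>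
    (max_le_max le_rfl (hlam n hn)).trans (max_le_norm_ofReal_sub ht (hre n hn))
  have hmax : ∀ t : ℝ, 0 < max t c := fun t => lt_max_of_lt_right hc
  have hmem : ∀ t : ℝ, 0 ≤ t → (t : ℂ) ∈ opResolventSet A := fun t ht =>
    hA.mem_opResolventSet hφ hψ hι (hmax t) (hlow t ht)
  have hco : ∀ t : ℝ, 0 ≤ t → ∀ n x, (inner ℂ (ψ n) (ι (opResolvent A t x)) : ℂ) =
      ((t : ℂ) - lam n)⁻¹ * inner ℂ (ψ n) (ι x) := fun t ht n x =>
    hA.coord_opResolvent' hι (hmem t ht)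
      (fun n hn => norm_pos_iff.1 ((hmax t).trans_le (hlow t ht n hn))) n x
  have hpow : ∀ (k : ℕ) n, n ∈ N → ∀ x,
      ‖(inner ℂ (ψ n) (ι ((opResolvent A 0 ^ k) x)) : ℂ)‖ =
        ‖lam n‖ ^ (-(k : ℝ)) * ‖(inner ℂ (ψ n) (ι x) : ℂ)‖ := by
    intro k
    induction k with
    | zero => intro n _ x; simp
    | succ k ih =>
      intro n hn x
      have h0 := hco 0 le_rfl n x
      rw [Complex.ofReal_zero] at h0
      have hpos : 0 < ‖lam n‖ := hc.trans_le (hlam n hn)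
      rw [pow_succ, mul_apply_eq_comp, ih n hn, h0, norm_mul, norm_inv, zero_sub, norm_neg,
        ← mul_assoc]
      congr 1
      rw [Nat.cast_add, neg_add, Real.rpow_add hpos, Nat.cast_one, Real.rpow_neg_one]
  have hfl : (⌊δ⌋₊ : ℝ) + Int.fract δ = δ := by
    rw [natCast_floor_eq_intCast_floor hδ]
    exact Int.floor_add_fract δ
  unfold negFracPow
  split_ifs with h0
  · rw [h0, add_zero] at hfl
    refine ⟨1, one_pos, fun n hn x => ?_⟩
    rw [mul_one, hpow _ n hn, hfl, one_mul]
  · set s := Int.fract δ with hs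
    have hs0 : 0 < s := lt_of_le_of_ne (Int.fract_nonneg δ) (Ne.symm h0)
    have hs1 : s < 1 := Int.fract_lt_one δ
    obtain ⟨C, hC, hRb⟩ := hA.exists_opResolvent_bound hφ hψ hι
    have hint : IntegrableOn (fun t : ℝ => ((t ^ (-s) : ℝ) : ℂ) • opResolvent A (t : ℂ))
        (Set.Ioi 0) := by
      refine Integrable.mono' ((integrableOn_rpow_mul_inv_max hs0 hs1 hc).1.const_mul C) ?_ ?_
      · refine ContinuousOn.aestronglyMeasurable (fun t ht => ContinuousAt.continuousWithinAt ?_)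
          measurableSet_Ioi
        have ht' : 0 < t := ht
        refine ContinuousAt.smul (Complex.continuous_ofReal.continuousAt.comp
          (Real.continuousAt_rpow_const _ _ (Or.inl ht'.ne'))) ?_
        exact (hA.continuousAt_opResolvent hφ hψ hι (hmax t) (hlow t ht'.le)).comp
          (f := fun t : ℝ => (t : ℂ)) Complex.continuous_ofReal.continuousAt
      · filter_upwards [ae_restrict_mem measurableSet_Ioi] with t ht
        have ht' : 0 < t := ht
        rw [norm_smul, Complex.norm_real, Real.norm_of_nonneg (by positivity)]
        calc t ^ (-s) * ‖opResolvent A (t : ℂ)‖ ≤ t ^ (-s) * (C * (max t c)⁻¹) := by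
              gcongr
              exact (hRb _ (hmax t) t (hlow t ht'.le)).1
          _ = _ := by ring
    -- The summand 1 merely makes the constant visibly positive, without checking that the sine is
    -- nonzero.
    refine ⟨‖((Real.sin (Real.pi * s) / Real.pi : ℝ) : ℂ)‖ * ((1 - s)⁻¹ + s⁻¹) + 1, ?_,
      fun n hn x => ?_⟩
    · have : 0 < 1 - s := by linarith
      positivity
    · have hpos : 0 < ‖lam n‖ := hc.trans_le (hlam n hn)
      have h1 := ((innerSL ℂ (ψ n)).comp (ι.toContinuousLinearMap.comp
        (ContinuousLinearMap.apply ℂ E x : (E →L[ℂ] E) →L[ℂ] E))).integral_comp_comm hint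
      simp only [ContinuousLinearMap.comp_apply, innerSL_apply_apply,
        ContinuousLinearMap.apply_apply, LinearIsometry.coe_toContinuousLinearMap] at h1
      have h2 : ‖(inner ℂ (ψ n) (ι ((∫ t in Set.Ioi (0 : ℝ), ((t ^ (-s) : ℝ) : ℂ) •
          opResolvent A (t : ℂ)) x)) : ℂ)‖ ≤
          ((1 - s)⁻¹ + s⁻¹) * ‖lam n‖ ^ (-s) * ‖(inner ℂ (ψ n) (ι x) : ℂ)‖ := by
        rw [← h1, ← (integrableOn_rpow_mul_inv_max hs0 hs1 hpos).2, ← integral_mul_const]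
        refine norm_integral_le_of_norm_le
          ((integrableOn_rpow_mul_inv_max hs0 hs1 hpos).1.mul_const _) ?_
        filter_upwards [ae_restrict_mem measurableSet_Ioi] with t ht
        have ht' : 0 < t := ht
        rw [smul_apply, map_smul, inner_smul_right, hco t ht'.le, norm_mul,
          Complex.norm_real, Real.norm_of_nonneg (by positivity), norm_mul, norm_inv, ← mul_assoc]
        gcongr
        exact max_le_norm_ofReal_sub ht'.le (hre n hn)
      rw [mul_apply_eq_comp, hpow _ n hn, smul_apply, map_smul, inner_smul_right, norm_mul]
      have e : ‖lam n‖ ^ (-δ) = ‖lam n‖ ^ (-(⌊δ⌋₊ : ℝ)) * ‖lam n‖ ^ (-s) := by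
        rw [← Real.rpow_add hpos, ← neg_add, hfl]
      rw [e]
      calc _ ≤ ‖lam n‖ ^ (-(⌊δ⌋₊ : ℝ)) * (‖((Real.sin (Real.pi * s) / Real.pi : ℝ) : ℂ)‖ *
            (((1 - s)⁻¹ + s⁻¹) * ‖lam n‖ ^ (-s) * ‖(inner ℂ (ψ n) (ι x) : ℂ)‖)) := by gcongr
        _ = ‖((Real.sin (Real.pi * s) / Real.pi : ℝ) : ℂ)‖ * ((1 - s)⁻¹ + s⁻¹) *
            (‖lam n‖ ^ (-(⌊δ⌋₊ : ℝ)) * ‖lam n‖ ^ (-s)) * ‖(inner ℂ (ψ n) (ι x) : ℂ)‖ := by ring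
        _ ≤ _ := by
          gcongr
          linarith

end FractionalPower

/-! ### Integrals of powers of the distance to a point of the disc -/

section CircleIntegrals

theorem norm_circlePt {r : ℝ} (hr : 0 ≤ r) (θ : ℝ) : ‖circlePt r θ‖ = r := by
  rw [circlePt, norm_mul, mul_comm Complex.I, Complex.norm_exp_ofReal_mul_I, mul_one,
    Complex.norm_real, Real.norm_of_nonneg hr]

theorem continuous_circlePt (r : ℝ) : Continuous (circlePt r) := by
  unfold circlePt
  fun_prop

theorem sub_norm_le_norm_circlePt_sub {r : ℝ} (hr : 0 ≤ r) (θ : ℝ) (q : ℂ) :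
    r - ‖q‖ ≤ ‖circlePt r θ - q‖ := by
  have := norm_sub_norm_le (circlePt r θ) q
  rwa [norm_circlePt hr] at this

/-- For |θ| ≤ π/2 the imaginary part r sin θ is large enough. For larger |θ| the cosine is
nonpositive, so the squared distance is at least r² ≥ 1. -/
theorem abs_div_pi_le_norm_circlePt_sub {r ρ θ : ℝ} (hr : 1 ≤ r) (hρ : 0 ≤ ρ)
    (hθ : |θ| ≤ Real.pi) : |θ| / Real.pi ≤ ‖circlePt r θ - ρ‖ := by
  have hπ := Real.pi_pos
  have hre : (circlePt r θ).re = r * Real.cos θ := by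
    simp [circlePt, mul_comm Complex.I, Complex.exp_ofReal_mul_I_re]
  have him : (circlePt r θ).im = r * Real.sin θ := by
    simp [circlePt, mul_comm Complex.I, Complex.exp_ofReal_mul_I_im]
  rcases le_total |θ| (Real.pi / 2) with h | h
  · have h1 := Complex.abs_im_le_norm (circlePt r θ - ρ)
    rw [Complex.sub_im, him, Complex.ofReal_im, sub_zero, abs_mul, abs_of_nonneg (by linarith)] at h1
    have h2 := Real.mul_abs_le_abs_sin h
    have h3 : 0 ≤ |θ| / Real.pi := by positivity
    have h4 : 2 / Real.pi * |θ| = 2 * (|θ| / Real.pi) := by ring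
    nlinarith [abs_nonneg (Real.sin θ)]
  · have h1 : Real.cos θ ≤ 0 := by
      rw [← Real.cos_abs]
      exact Real.cos_nonpos_of_pi_div_two_le_of_le h (by linarith)
    have h2 : |θ| / Real.pi ≤ 1 := (div_le_one hπ).2 hθ
    refine h2.trans (le_of_sq_le_sq ?_ (norm_nonneg _))
    rw [Complex.sq_norm, Complex.normSq_apply, Complex.sub_re, Complex.sub_im, hre, him,
      Complex.ofReal_re, Complex.ofReal_im]
    have h3 := Real.sin_sq_add_cos_sq θ
    have h4 : 0 ≤ r * ρ * -Real.cos θ := mul_nonneg (by positivity) (by linarith)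
    have h5 : (r * Real.cos θ - ρ) * (r * Real.cos θ - ρ) +
        (r * Real.sin θ - 0) * (r * Real.sin θ - 0) =
        r ^ 2 * (Real.sin θ ^ 2 + Real.cos θ ^ 2) + 2 * (r * ρ * -Real.cos θ) + ρ ^ 2 := by ring
    rw [h5, h3]
    nlinarith [sq_nonneg ρ]

theorem continuous_norm_circlePt_sub_rpow {r : ℝ} {q : ℂ} (hr : 0 ≤ r) (hq : ‖q‖ < r) (s : ℝ) :
    Continuous fun θ => ‖circlePt r θ - q‖ ^ s := by
  refine Continuous.rpow_const (by have := continuous_circlePt r; fun_prop) fun θ => Or.inl ?_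
  have := sub_norm_le_norm_circlePt_sub hr θ q
  linarith

/-- A rotation moves q to the real point |q|. There the distance is at least (r - 1 + |θ|)/(2π),
which turns the circle integral into an elementary one, independent of q. -/
theorem integral_norm_circlePt_sub_rpow_le {r : ℝ} {q : ℂ} (hr : 1 < r) (hq : ‖q‖ ≤ 1) {s : ℝ}
    (hs : 0 ≤ s) : ∫ θ in (0 : ℝ)..(2 * Real.pi), ‖circlePt r θ - q‖ ^ (-s) ≤
      2 * (2 * Real.pi) ^ s * ∫ u in (r - 1)..(r - 1 + Real.pi), u ^ (-s) := by
  have hπ := Real.pi_pos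
  have hr0 : 0 ≤ r := by linarith
  have hε : 0 < r - 1 := by linarith
  have hper : Function.Periodic (fun θ => ‖circlePt r θ - q‖ ^ (-s)) (2 * Real.pi) := by
    intro θ
    have : circlePt r (θ + 2 * Real.pi) = circlePt r θ := by
      unfold circlePt
      congr 1
      have e : Complex.I * ((θ + 2 * Real.pi : ℝ) : ℂ) =
        Complex.I * (θ : ℂ) + 2 * Real.pi * Complex.I := by push_cast; ring
      rw [e, Complex.exp_periodic]
    simp only [this]
  have hshift : ∫ θ in (0 : ℝ)..(2 * Real.pi), ‖circlePt r θ - q‖ ^ (-s) =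
      ∫ θ in (-Real.pi)..Real.pi, ‖circlePt r θ - (‖q‖ : ℝ)‖ ^ (-s) := by
    have h1 := hper.intervalIntegral_add_eq 0 (-Real.pi + q.arg)
    rw [zero_add] at h1
    rw [h1]
    have e : -Real.pi + q.arg + 2 * Real.pi = Real.pi + q.arg := by ring
    rw [e, ← intervalIntegral.integral_comp_add_right]
    refine intervalIntegral.integral_congr fun θ _ => ?_
    have h2 : circlePt r (θ + q.arg) - q =
        (circlePt r θ - (‖q‖ : ℝ)) * Complex.exp (q.arg * Complex.I) := by
      rw [sub_mul, Complex.norm_mul_exp_arg_mul_I]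
      congr 1
      unfold circlePt
      rw [mul_assoc, ← Complex.exp_add]
      congr 2
      push_cast
      ring
    simp only [h2, norm_mul, Complex.norm_exp_ofReal_mul_I, mul_one]
  rw [hshift]
  have hqn : ‖((‖q‖ : ℝ) : ℂ)‖ = ‖q‖ := by simp
  have hpt : ∀ θ ∈ Set.Icc (-Real.pi) Real.pi, ‖circlePt r θ - (‖q‖ : ℝ)‖ ^ (-s) ≤
      (2 * Real.pi) ^ s * (r - 1 + |θ|) ^ (-s) := by
    intro θ hθ
    have h1 := abs_div_pi_le_norm_circlePt_sub hr.le (norm_nonneg q) (abs_le.2 hθ)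
    have h2 := sub_norm_le_norm_circlePt_sub hr0 θ (‖q‖ : ℝ)
    rw [hqn] at h2
    have h3 : 0 < r - 1 + |θ| := by positivity
    -- This averages the radial lower bound r - 1 ≥ (r - 1)/π with the angular one |θ|/π.
    have h4 : (2 * Real.pi)⁻¹ * (r - 1 + |θ|) ≤ ‖circlePt r θ - (‖q‖ : ℝ)‖ := by
      have h5 : (r - 1) / Real.pi ≤ r - 1 := div_le_self hε.le (by linarith [Real.two_le_pi])
      have h6 : (2 * Real.pi)⁻¹ * (r - 1 + |θ|) = ((r - 1) / Real.pi + |θ| / Real.pi) / 2 := by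
        field_simp
      rw [h6]
      linarith
    calc _ ≤ ((2 * Real.pi)⁻¹ * (r - 1 + |θ|)) ^ (-s) :=
          Real.rpow_le_rpow_of_nonpos (by positivity) h4 (by linarith)
      _ = _ := by
        rw [Real.mul_rpow (by positivity) h3.le, Real.inv_rpow (by positivity),
          Real.rpow_neg (by positivity), inv_inv]
  have hcont : Continuous fun θ : ℝ => (2 * Real.pi) ^ s * (r - 1 + |θ|) ^ (-s) := by
    refine continuous_const.mul (Continuous.rpow_const (by fun_prop) fun θ => Or.inl ?_)
    positivity
  have hcont' := continuous_norm_circlePt_sub_rpow hr0 (q := (‖q‖ : ℝ))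
    (by rw [hqn]; linarith) (-s)
  refine (intervalIntegral.integral_mono_on (by linarith) (hcont'.intervalIntegrable _ _)
    (hcont.intervalIntegrable _ _) hpt).trans (le_of_eq ?_)
  rw [intervalIntegral.integral_const_mul, ← intervalIntegral.integral_add_adjacent_intervals
    (b := 0) (by
      refine Continuous.intervalIntegrable ?_ _ _
      exact Continuous.rpow_const (by fun_prop) fun θ => Or.inl (by positivity)) (by
      refine Continuous.intervalIntegrable ?_ _ _
      exact Continuous.rpow_const (by fun_prop) fun θ => Or.inl (by positivity))]
  have e1 : ∫ θ in (0 : ℝ)..Real.pi, (r - 1 + |θ|) ^ (-s) =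
      ∫ u in (r - 1)..(r - 1 + Real.pi), u ^ (-s) := by
    have := intervalIntegral.integral_comp_add_left (a := 0) (b := Real.pi)
      (fun u : ℝ => u ^ (-s)) (r - 1)
    rw [add_zero] at this
    rw [← this]
    refine intervalIntegral.integral_congr fun θ hθ => ?_
    rw [Set.uIcc_of_le hπ.le] at hθ
    simp only [abs_of_nonneg hθ.1]
  have e2 : ∫ θ in (-Real.pi)..0, (r - 1 + |θ|) ^ (-s) =
      ∫ θ in (0 : ℝ)..Real.pi, (r - 1 + |θ|) ^ (-s) := by
    have := intervalIntegral.integral_comp_neg (a := 0) (b := Real.pi)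
      (fun θ : ℝ => (r - 1 + |θ|) ^ (-s))
    simp only [abs_neg, neg_zero] at this
    exact this.symm
  rw [e2, e1]
  ring

theorem weightLambda_nonneg (η : ℝ) {r : ℝ} (hr : 1 < r) : 0 ≤ weightLambda η r := by
  have : 0 ≤ r - 1 := by linarith
  unfold weightLambda
  split_ifs <;> positivity

theorem tendsto_weightLambda {η : ℝ} (hη : η ≤ 1 / 2) :
    Tendsto (weightLambda η) (𝓝[>] 1) (𝓝 0) := by
  have h0 : Tendsto (fun r : ℝ => r - 1) (𝓝[>] 1) (𝓝[>] 0) := by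
    refine tendsto_nhdsWithin_iff.2 ⟨?_, ?_⟩
    · have : Tendsto (fun s : ℝ => s - 1) (𝓝 1) (𝓝 (1 - 1)) :=
        (continuous_id.sub continuous_const).tendsto 1
      rw [sub_self] at this
      exact this.mono_left nhdsWithin_le_nhds
    · filter_upwards [self_mem_nhdsWithin] with s hs
      exact Set.mem_Ioi.2 (sub_pos.2 (Set.mem_Ioi.1 hs))
  unfold weightLambda
  split_ifs with h
  · exact (tendsto_abs_atBot_atTop.comp (Real.tendsto_log_nhdsGT_zero.comp h0)).inv_tendsto_atTop
  · have h1 : 0 < 1 - 2 * η := by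
      have := lt_of_le_of_ne hη h
      linarith
    have h2 := (Real.continuousAt_rpow_const 0 (1 - 2 * η) (Or.inr h1.le)).tendsto
    rw [Real.zero_rpow h1.ne'] at h2
    exact (h2.mono_left nhdsWithin_le_nhds).comp h0

/-- The integral of u^{-(2-2η)} from r - 1 on grows like (r - 1)^{-(1-2η)}, or like |log(r - 1)|
when η = 1/2; the weight is the reciprocal order of growth. -/
theorem exists_weightLambda_mul_integral_le {η : ℝ} (hη : η ≤ 1 / 2) :
    ∃ K : ℝ, ∀ r : ℝ, 1 < r → r < 3 / 2 → ∀ q : ℂ, ‖q‖ ≤ 1 →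
      weightLambda η r * ∫ θ in (0 : ℝ)..(2 * Real.pi),
        ‖circlePt r θ - q‖ ^ (-(2 - 2 * η)) ≤ K := by
  have hπ := Real.pi_pos
  have hmain : ∃ K : ℝ, ∀ r : ℝ, 1 < r → r < 3 / 2 → weightLambda η r *
      ∫ u in (r - 1)..(r - 1 + Real.pi), u ^ (-(2 - 2 * η)) ≤ K := by
    rcases hη.lt_or_eq with h | h
    · refine ⟨(1 - 2 * η)⁻¹, fun r hr _ => ?_⟩
      have hε : 0 < r - 1 := by linarith
      have hp : 0 < 1 - 2 * η := by linarith
      rw [integral_rpow (Or.inr ⟨by linarith, by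
        rw [Set.uIcc_of_le (by linarith)]; exact fun h => by linarith [h.1]⟩), weightLambda,
        if_neg h.ne]
      have e : -(2 - 2 * η) + 1 = -(1 - 2 * η) := by ring
      have h1 : 0 ≤ (r - 1 + Real.pi) ^ (-(1 - 2 * η)) := by positivity
      have h2 : (r - 1) ^ (1 - 2 * η) * (r - 1) ^ (-(1 - 2 * η)) = 1 := by
        rw [← Real.rpow_add hε, add_neg_cancel, Real.rpow_zero]
      have h3 : 0 ≤ (r - 1) ^ (1 - 2 * η) := by positivity
      rw [e, div_neg, ← neg_div, neg_sub, ← mul_div_assoc, inv_eq_one_div]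
      gcongr
      rw [mul_sub, h2]
      have := mul_nonneg h3 h1
      linarith
    -- Since r - 1 < 1/2 and r - 1 + π < 4, log(r - 1 + π) ≤ 2 log 2 ≤ 2|log(r - 1)|, and -log(r -
    -- 1) contributes the third copy.
    · refine ⟨3, fun r hr hr2 => ?_⟩
      have hε : 0 < r - 1 := by linarith
      have e : ∀ u : ℝ, u ^ (-(2 - 2 * η)) = u⁻¹ := fun u => by
        rw [h, ← Real.rpow_neg_one]; norm_num
      simp only [e]
      rw [integral_inv (by
        rw [Set.uIcc_of_le (by linarith)]; exact fun h => by linarith [h.1]), weightLambda,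
        if_pos h, Real.log_div (by positivity) hε.ne']
      have h1 : Real.log (r - 1) ≤ - Real.log 2 := by
        rw [← Real.log_inv]
        exact Real.log_le_log hε (by norm_num; linarith)
      have h2 : Real.log (r - 1 + Real.pi) ≤ 2 * Real.log 2 := by
        have : 2 * Real.log 2 = Real.log 4 := by
          rw [show (4 : ℝ) = 2 ^ 2 by norm_num, Real.log_pow]; norm_num
        rw [this]
        exact Real.log_le_log (by positivity) (by linarith [Real.pi_lt_d2])
      have h3 := Real.log_pos one_lt_two
      rw [abs_of_neg (by linarith), inv_mul_le_iff₀ (by linarith)]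
      linarith
  obtain ⟨K, hK⟩ := hmain
  refine ⟨2 * (2 * Real.pi) ^ (2 - 2 * η) * K, fun r hr hr2 q hq => ?_⟩
  calc _ ≤ weightLambda η r * (2 * (2 * Real.pi) ^ (2 - 2 * η) *
        ∫ u in (r - 1)..(r - 1 + Real.pi), u ^ (-(2 - 2 * η))) :=
        mul_le_mul_of_nonneg_left (integral_norm_circlePt_sub_rpow_le hr hq (by linarith))
          (weightLambda_nonneg η hr)
    _ = 2 * (2 * Real.pi) ^ (2 - 2 * η) * (weightLambda η r *
        ∫ u in (r - 1)..(r - 1 + Real.pi), u ^ (-(2 - 2 * η))) := by ring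
    _ ≤ _ := mul_le_mul_of_nonneg_left (hK r hr hr2) (by positivity)

theorem integral_norm_circlePt_sub_rpow_nonneg (r : ℝ) (q : ℂ) (s : ℝ) :
    0 ≤ ∫ θ in (0 : ℝ)..(2 * Real.pi), ‖circlePt r θ - q‖ ^ s :=
  intervalIntegral.integral_nonneg (by have := Real.pi_pos; positivity) fun θ _ => by positivity

/-- For fixed |q| < 1 the integrand stays below (1 - |q|)^{-s} for all r > 1, so the vanishing
weight decides. -/
theorem tendsto_weightLambda_mul_integral {η : ℝ} (hη : η ≤ 1 / 2) {q : ℂ} (hq : ‖q‖ < 1) {s : ℝ}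
    (hs : 0 ≤ s) :
    Tendsto (fun r => weightLambda η r * ∫ θ in (0 : ℝ)..(2 * Real.pi),
      ‖circlePt r θ - q‖ ^ (-s)) (𝓝[>] 1) (𝓝 0) := by
  have hπ := Real.pi_pos
  have h1 := (tendsto_weightLambda hη).mul_const ((1 - ‖q‖) ^ (-s) * |2 * Real.pi - 0|)
  rw [zero_mul] at h1
  refine squeeze_zero' ?_ ?_ h1
  · filter_upwards [self_mem_nhdsWithin] with r hr
    exact mul_nonneg (weightLambda_nonneg η hr) (integral_norm_circlePt_sub_rpow_nonneg _ _ _)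
  · filter_upwards [self_mem_nhdsWithin] with r hr
    have hr' : 1 < r := hr
    refine mul_le_mul_of_nonneg_left ?_ (weightLambda_nonneg η hr)
    refine (le_abs_self _).trans ?_
    rw [← Real.norm_eq_abs]
    refine intervalIntegral.norm_integral_le_of_norm_le_const fun θ _ => ?_
    rw [Real.norm_of_nonneg (by positivity)]
    refine Real.rpow_le_rpow_of_nonpos (by linarith) ?_ (by linarith)
    have := sub_norm_le_norm_circlePt_sub (r := r) (by linarith) θ q
    linarith

theorem norm_circlePt_sub_rpow_le {r : ℝ} {q : ℂ} (hr : 1 < r) (hq : ‖q‖ < 1) {s : ℝ}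
    (hs : 0 ≤ s) (θ : ℝ) : ‖circlePt r θ - q‖ ^ (-s) ≤ (r - 1) ^ (-s) := by
  refine Real.rpow_le_rpow_of_nonpos (by linarith) ?_ (by linarith)
  have := sub_norm_le_norm_circlePt_sub (r := r) (by linarith) θ q
  linarith

theorem summable_mul_norm_circlePt_sub_rpow {c : ℕ → ℝ} {q : ℕ → ℂ} (hc : ∀ n, 0 ≤ c n)
    (hcs : Summable c) (hq : ∀ n, ‖q n‖ < 1) {s : ℝ} (hs : 0 ≤ s) {r : ℝ} (hr : 1 < r) (θ : ℝ) :
    Summable fun n => c n * ‖circlePt r θ - q n‖ ^ (-s) :=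
  Summable.of_nonneg_of_le (fun n => mul_nonneg (hc n) (by positivity))
    (fun n => mul_le_mul_of_nonneg_left (norm_circlePt_sub_rpow_le hr (hq n) hs θ) (hc n))
    (hcs.mul_right _)

theorem continuous_tsum_mul_norm_circlePt_sub_rpow {c : ℕ → ℝ} {q : ℕ → ℂ} (hc : ∀ n, 0 ≤ c n)
    (hcs : Summable c) (hq : ∀ n, ‖q n‖ < 1) {s : ℝ} (hs : 0 ≤ s) {r : ℝ} (hr : 1 < r) :
    Continuous fun θ => ∑' n, c n * ‖circlePt r θ - q n‖ ^ (-s) := by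
  refine continuous_tsum (fun n => continuous_const.mul
    (continuous_norm_circlePt_sub_rpow (by linarith) ((hq n).trans hr) _))
    (hcs.mul_right ((r - 1) ^ (-s))) fun n θ => ?_
  rw [Real.norm_of_nonneg (mul_nonneg (hc n) (by positivity))]
  exact mul_le_mul_of_nonneg_left (norm_circlePt_sub_rpow_le hr (hq n) hs θ) (hc n)

/-- Dominated convergence in n: each term tends to 0, and the bound uniform in q makes the summable
sequence K cₙ a majorant. This is where mere boundedness improves to convergence to 0. -/
theorem tendsto_weightLambda_mul_integral_tsum {η : ℝ} (hη : η ≤ 1 / 2) {c : ℕ → ℝ} {q : ℕ → ℂ}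
    (hc : ∀ n, 0 ≤ c n) (hcs : Summable c) (hq : ∀ n, ‖q n‖ < 1) :
    Tendsto (fun r => weightLambda η r * ∫ θ in (0 : ℝ)..(2 * Real.pi),
      ∑' n, c n * ‖circlePt r θ - q n‖ ^ (-(2 - 2 * η))) (𝓝[>] 1) (𝓝 0) := by
  have hs : 0 ≤ 2 - 2 * η := by linarith
  obtain ⟨K, hK⟩ := exists_weightLambda_mul_integral_le hη
  have hlim : Tendsto (fun r => ∑' n, c n * (weightLambda η r * ∫ θ in (0 : ℝ)..(2 * Real.pi),
      ‖circlePt r θ - q n‖ ^ (-(2 - 2 * η)))) (𝓝[>] 1) (𝓝 (∑' n : ℕ, c n * 0)) := by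
    refine tendsto_tsum_of_dominated_convergence (hcs.mul_right K)
      (fun n => (tendsto_weightLambda_mul_integral hη (hq n) hs).const_mul (c n)) ?_
    filter_upwards [Ioo_mem_nhdsGT (show (1 : ℝ) < 3 / 2 by norm_num)] with r hr n
    rw [Real.norm_of_nonneg (mul_nonneg (hc n) (mul_nonneg (weightLambda_nonneg η hr.1)
      (integral_norm_circlePt_sub_rpow_nonneg _ _ _)))]
    exact mul_le_mul_of_nonneg_left (hK r hr.1 hr.2 _ (hq n).le) (hc n)
  simp only [mul_zero, tsum_zero] at hlim
  refine hlim.congr' ?_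
  filter_upwards [self_mem_nhdsWithin] with r hr
  have hr' : 1 < r := hr
  have h1 := intervalIntegral.hasSum_integral_of_dominated_convergence (μ := volume) (a := 0)
    (b := 2 * Real.pi) (F := fun n θ => c n * ‖circlePt r θ - q n‖ ^ (-(2 - 2 * η)))
    (f := fun θ => ∑' n, c n * ‖circlePt r θ - q n‖ ^ (-(2 - 2 * η)))
    (fun n _ => c n * (r - 1) ^ (-(2 - 2 * η)))
    (fun n => (continuous_const.mul (continuous_norm_circlePt_sub_rpow (by linarith)
      ((hq n).trans hr') _)).aestronglyMeasurable)
    (fun n => Eventually.of_forall fun θ _ => by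
      rw [Real.norm_of_nonneg (mul_nonneg (hc n) (by positivity))]
      exact mul_le_mul_of_nonneg_left (norm_circlePt_sub_rpow_le hr' (hq n) hs θ) (hc n))
    (Eventually.of_forall fun θ _ => hcs.mul_right _)
    intervalIntegrable_const
    (Eventually.of_forall fun θ _ =>
      (summable_mul_norm_circlePt_sub_rpow hc hcs hq hs hr' θ).hasSum)
  rw [← h1.tsum_eq, ← tsum_mul_left]
  refine tsum_congr fun n => ?_
  rw [intervalIntegral.integral_const_mul]
  ring

end CircleIntegrals

/-! ### Interpolation of the product of two sums -/

section Product

/-- A substitute for Jensen's inequality, with a cruder constant: y^w ≤ y + 1 for y = xₙ/t ≥ 0,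
multiplied by cₙ and summed. -/
theorem tsum_mul_rpow_le {c x : ℕ → ℝ} (hc : ∀ n, 0 ≤ c n) (hx : ∀ n, 0 ≤ x n) (hcs : Summable c)
    (hcx : Summable fun n => c n * x n) {w t : ℝ} (hw0 : 0 ≤ w) (hw1 : w ≤ 1) (ht : 0 < t)
    (hle : ∑' n, c n * x n ≤ t) :
    (Summable fun n => c n * x n ^ w) ∧ ∑' n, c n * x n ^ w ≤ t ^ w * (1 + ∑' n, c n) := by
  have hpt : ∀ n, c n * x n ^ w ≤ t ^ w * (t⁻¹ * (c n * x n) + c n) := by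
    intro n
    have h1 : (x n / t) ^ w ≤ x n / t + 1 := by
      have h0 : 0 ≤ x n / t := div_nonneg (hx n) ht.le
      rcases le_total (x n / t) 1 with h | h
      · linarith [Real.rpow_le_one h0 h hw0]
      · have := Real.rpow_le_rpow_of_exponent_le h hw1
        rw [Real.rpow_one] at this
        linarith
    rw [Real.div_rpow (hx n) ht.le, div_le_iff₀ (by positivity)] at h1
    calc c n * x n ^ w ≤ c n * ((x n / t + 1) * t ^ w) := mul_le_mul_of_nonneg_left h1 (hc n)
      _ = _ := by rw [div_eq_mul_inv]; ring
  have hsum : Summable fun n => t ^ w * (t⁻¹ * (c n * x n) + c n) :=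
    ((hcx.mul_left _).add hcs).mul_left _
  have hs := Summable.of_nonneg_of_le (fun n => mul_nonneg (hc n) (Real.rpow_nonneg (hx n) _))
    hpt hsum
  refine ⟨hs, (hs.tsum_le_tsum hpt hsum).trans ?_⟩
  rw [tsum_mul_left, (hcx.mul_left _).tsum_add hcs, tsum_mul_left]
  gcongr
  rw [inv_mul_le_iff₀ ht, mul_one]
  exact hle

/-- The weighted integral mean of a product of two sums of the type `∑ gₙ |z - qₙ|⁻²` tends to
zero. -/
theorem tendsto_weightLambda_mul_integral_mul {η α a K C : ℝ} (hη0 : 0 ≤ η) (hη : η ≤ 1 / 2)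
    (hα : 0 < α) (ha0 : η * α ≤ a) (ha1 : a ≤ α) (hK : 0 < K) (hC : 0 ≤ C) {l g h : ℕ → ℝ}
    {q : ℕ → ℂ} (hq : ∀ n, ‖q n‖ < 1) (hl : ∀ n, 0 < l n)
    (hlq : ∀ n, l n ^ (-α) ≤ K * (1 - ‖q n‖)) (hg0 : ∀ n, 0 ≤ g n) (hh0 : ∀ n, 0 ≤ h n)
    (hg : Summable fun n => g n * l n ^ (2 * a))
    (hh : Summable fun n => h n * l n ^ (2 * (α - a + η * α))) {G H : ℝ → ℝ → ℝ}
    (hG0 : ∀ r θ, 0 ≤ G r θ) (hH0 : ∀ r θ, 0 ≤ H r θ)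
    (hG : ∀ᶠ r in 𝓝[>] (1 : ℝ), ∀ θ,
      (Summable fun n => g n * (‖circlePt r θ - q n‖⁻¹) ^ 2) →
      G r θ ≤ C * ∑' n, g n * (‖circlePt r θ - q n‖⁻¹) ^ 2)
    (hH : ∀ᶠ r in 𝓝[>] (1 : ℝ), ∀ θ,
      (Summable fun n => h n * (‖circlePt r θ - q n‖⁻¹) ^ 2) →
      H r θ ≤ C * ∑' n, h n * (‖circlePt r θ - q n‖⁻¹) ^ 2) :
    Tendsto (fun r => weightLambda η r * ∫ θ in (0 : ℝ)..(2 * Real.pi), G r θ * H r θ)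
      (𝓝[>] 1) (𝓝 0) := by
  have hπ := Real.pi_pos
  set s := 2 - 2 * η with hs
  have hs1 : 1 ≤ s := by linarith
  have hs0 : 0 ≤ s := by linarith
  -- a single sum against powers of the circle distance
  have hkey : ∀ (k : ℕ → ℝ) (e w : ℝ), (∀ n, 0 ≤ k n) → 0 ≤ e → 0 ≤ w → w ≤ 1 →
      s * w = 2 - 2 * e / α → (Summable fun n => k n * l n ^ (2 * e)) →
      ∀ r : ℝ, 1 < r → ∀ θ t : ℝ, 0 < t →
      ∑' n, (k n * l n ^ (2 * e)) * ‖circlePt r θ - q n‖ ^ (-s) ≤ t →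
      (Summable fun n => k n * (‖circlePt r θ - q n‖⁻¹) ^ 2) ∧
      ∑' n, k n * (‖circlePt r θ - q n‖⁻¹) ^ 2 ≤
        K ^ (2 * e / α) * (1 + ∑' n, k n * l n ^ (2 * e)) * t ^ w := by
    intro k e w hk he hw0 hw1 hsw hks r hr θ t ht hle
    have hpos : ∀ n, 0 < ‖circlePt r θ - q n‖ := fun n => by
      have := sub_norm_le_norm_circlePt_sub (r := r) (by linarith) θ (q n)
      linarith [hq n]
    have hk' : ∀ n, 0 ≤ k n * l n ^ (2 * e) := fun n =>
      mul_nonneg (hk n) (Real.rpow_nonneg (hl n).le _)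
    obtain ⟨h1, h2⟩ := tsum_mul_rpow_le hk' (x := fun n => ‖circlePt r θ - q n‖ ^ (-s))
      (fun n => by positivity) hks
      (summable_mul_norm_circlePt_sub_rpow hk' hks hq hs0 hr θ) hw0 hw1 ht hle
    have hpt : ∀ n, k n * (‖circlePt r θ - q n‖⁻¹) ^ 2 ≤ K ^ (2 * e / α) *
        (k n * l n ^ (2 * e) * (‖circlePt r θ - q n‖ ^ (-s)) ^ w) := by
      intro n
      have hx := hpos n
      have hln := hl n
      have h3 : l n ^ (-α) ≤ K * ‖circlePt r θ - q n‖ := by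
        refine (hlq n).trans (mul_le_mul_of_nonneg_left ?_ hK.le)
        have := sub_norm_le_norm_circlePt_sub (r := r) (by linarith) θ (q n)
        linarith
      -- The exchange of smoothness for distance: `h3` raised to the power 2e/α says that the weight
      -- l^{2e} pays for a factor |z - q|^{2e/α}.
      have h4 : 1 ≤ K ^ (2 * e / α) * ‖circlePt r θ - q n‖ ^ (2 * e / α) * l n ^ (2 * e) := by
        have h5 := Real.rpow_le_rpow (by positivity) h3 (show 0 ≤ 2 * e / α by positivity)
        rw [← Real.rpow_mul hln.le, Real.mul_rpow hK.le hx.le] at h5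
        have e1 : -α * (2 * e / α) = -(2 * e) := by field_simp
        rw [e1] at h5
        calc (1 : ℝ) = l n ^ (-(2 * e)) * l n ^ (2 * e) := by
              rw [← Real.rpow_add hln, neg_add_cancel, Real.rpow_zero]
          _ ≤ _ := by gcongr
      have e2 : (‖circlePt r θ - q n‖ ^ (-s)) ^ w =
          ‖circlePt r θ - q n‖ ^ (2 * e / α) * (‖circlePt r θ - q n‖⁻¹) ^ 2 := by
        rw [← Real.rpow_mul hx.le, neg_mul, hsw, neg_sub, Real.rpow_sub hx, inv_pow,
          div_eq_mul_inv, Real.rpow_two]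
      rw [e2]
      calc k n * (‖circlePt r θ - q n‖⁻¹) ^ 2
          = 1 * (k n * (‖circlePt r θ - q n‖⁻¹) ^ 2) := (one_mul _).symm
        _ ≤ (K ^ (2 * e / α) * ‖circlePt r θ - q n‖ ^ (2 * e / α) * l n ^ (2 * e)) *
            (k n * (‖circlePt r θ - q n‖⁻¹) ^ 2) :=
            mul_le_mul_of_nonneg_right h4 (mul_nonneg (hk n) (by positivity))
        _ = _ := by ring
    have hsm := Summable.of_nonneg_of_le (fun n => mul_nonneg (hk n) (by positivity)) hpt
      (h1.mul_left _)
    refine ⟨hsm, (hsm.tsum_le_tsum hpt (h1.mul_left _)).trans ?_⟩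
    rw [tsum_mul_left]
    calc _ ≤ K ^ (2 * e / α) * (t ^ w * (1 + ∑' n, k n * l n ^ (2 * e))) := by gcongr
      _ = _ := by ring
  set g' := fun n => g n * l n ^ (2 * a) with hg'
  set h' := fun n => h n * l n ^ (2 * (α - a + η * α)) with hh'
  have hg'0 : ∀ n, 0 ≤ g' n := fun n => mul_nonneg (hg0 n) (Real.rpow_nonneg (hl n).le _)
  have hh'0 : ∀ n, 0 ≤ h' n := fun n => mul_nonneg (hh0 n) (Real.rpow_nonneg (hl n).le _)
  -- One sequence dominates both weights, so both sums are controlled by the same t. The geometric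
  -- term makes it strictly positive, since t has to be positive in `hkey`.
  set d := fun n => g' n + h' n + (1 / 2 : ℝ) ^ n with hd
  have hd0 : ∀ n, 0 < d n := fun n => by
    have := hg'0 n
    have := hh'0 n
    simp only [hd]
    positivity
  have hds : Summable d := (hg.add hh).add summable_geometric_two
  have ha : 0 ≤ a := le_trans (by positivity) ha0
  have hsne : s ≠ 0 := by linarith
  -- The interpolation exponents: they add up to 1, and the conditions ηα ≤ a ≤ α are precisely what
  -- makes them nonnegative.
  set w₁ := (2 - 2 * a / α) / s with hw1
  set w₂ := (2 - 2 * (α - a + η * α) / α) / s with hw2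
  have hsw1 : s * w₁ = 2 - 2 * a / α := mul_div_cancel₀ _ hsne
  have hsw2 : s * w₂ = 2 - 2 * (α - a + η * α) / α := mul_div_cancel₀ _ hsne
  have hww : w₁ + w₂ = 1 := by
    rw [hw1, hw2, ← add_div, div_eq_one_iff_eq hsne, hs]
    field_simp
    ring
  have hw1n : 0 ≤ w₁ := by
    refine div_nonneg ?_ hs0
    rw [sub_nonneg, div_le_iff₀ hα]
    linarith
  have hw2n : 0 ≤ w₂ := by
    refine div_nonneg ?_ hs0
    rw [sub_nonneg, div_le_iff₀ hα]
    linarith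
  set M := C * (K ^ (2 * a / α) * (1 + ∑' n, g' n)) *
    (C * (K ^ (2 * (α - a + η * α) / α) * (1 + ∑' n, h' n))) with hM
  have hlim := (tendsto_weightLambda_mul_integral_tsum hη (fun n => (hd0 n).le) hds hq).const_mul M
  rw [mul_zero] at hlim
  refine squeeze_zero' ?_ ?_ hlim
  · filter_upwards [self_mem_nhdsWithin] with r hr
    exact mul_nonneg (weightLambda_nonneg η hr) (intervalIntegral.integral_nonneg (by positivity)
      fun θ _ => mul_nonneg (hG0 r θ) (hH0 r θ))
  · filter_upwards [self_mem_nhdsWithin, hG, hH] with r hr hGr hHr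
    have hr' : 1 < r := hr
    rw [mul_left_comm]
    refine mul_le_mul_of_nonneg_left ?_ (weightLambda_nonneg η hr)
    rw [← intervalIntegral.integral_const_mul, intervalIntegral.integral_of_le (by positivity),
      intervalIntegral.integral_of_le (by positivity)]
    -- Only the majorant has to be integrable here; no measurability of `G` or `H` is required.
    refine integral_mono_of_nonneg
      (Eventually.of_forall fun θ => mul_nonneg (hG0 r θ) (hH0 r θ)) ?_
      (Eventually.of_forall fun θ => ?_)
    · have hcont := (continuous_tsum_mul_norm_circlePt_sub_rpow (fun n => (hd0 n).le) hds hq hs0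
        hr').const_mul M
      exact ((hcont.intervalIntegrable (μ := volume) 0 (2 * Real.pi)).1)
    · simp only
      set t := ∑' n, d n * ‖circlePt r θ - q n‖ ^ (-s) with ht
      have hsd := summable_mul_norm_circlePt_sub_rpow (fun n => (hd0 n).le) hds hq hs0 hr' θ
      have htpos : 0 < t := by
        refine hsd.tsum_pos (fun n => mul_nonneg (hd0 n).le (by positivity)) 0 ?_
        refine mul_pos (hd0 0) (Real.rpow_pos_of_pos ?_ _)
        have := sub_norm_le_norm_circlePt_sub (r := r) (by linarith) θ (q 0)
        linarith [hq 0]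
      have hle : ∀ k : ℕ → ℝ, (∀ n, 0 ≤ k n) → (∀ n, k n ≤ d n) → Summable k →
          ∑' n, k n * ‖circlePt r θ - q n‖ ^ (-s) ≤ t := fun k hk0 hkd hk =>
        (summable_mul_norm_circlePt_sub_rpow hk0 hk hq hs0 hr' θ).tsum_le_tsum
          (fun n => mul_le_mul_of_nonneg_right (hkd n) (by positivity)) hsd
      have hgd : ∀ n, g' n ≤ d n := fun n => by
        have := hh'0 n
        have : (0 : ℝ) ≤ (1 / 2) ^ n := by positivity
        simp only [hd]
        linarith
      have hhd : ∀ n, h' n ≤ d n := fun n => by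
        have := hg'0 n
        have : (0 : ℝ) ≤ (1 / 2) ^ n := by positivity
        simp only [hd]
        linarith
      obtain ⟨i1, j1⟩ := hkey g a w₁ hg0 ha hw1n (by linarith) hsw1 hg r hr' θ t htpos
        (hle g' hg'0 hgd hg)
      obtain ⟨i2, j2⟩ := hkey h (α - a + η * α) w₂ hh0
        (by have : 0 ≤ η * α := by positivity
            linarith) hw2n (by linarith) hsw2 hh r hr' θ t htpos
        (hle h' hh'0 hhd hh)
      have k1 := (hGr θ i1).trans (mul_le_mul_of_nonneg_left j1 hC)
      have k2 := (hHr θ i2).trans (mul_le_mul_of_nonneg_left j2 hC)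
      calc G r θ * H r θ ≤ _ := mul_le_mul k1 k2 (hH0 r θ) ((hG0 r θ).trans k1)
        _ = M * (t ^ w₁ * t ^ w₂) := by rw [hM]; ring
        _ = M * t := by rw [← Real.rpow_add htpos, hww, Real.rpow_one]

end Product

/-! ### Consequences of the spectral assumptions -/

section SpectralBounds

/-- The eigenvalues `exp (lam n * τ)` of `T τ`, with those outside of the unit disc replaced by
`0`. -/
noncomputable def stableMultiplier (lam : ℕ → ℂ) (τ : ℝ) (n : ℕ) : ℂ :=
  if 0 < (lam n).re then 0 else Complex.exp (lam n * τ)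

variable {lam : ℕ → ℂ} {ω α Υ τ : ℝ}

theorem norm_exp_mul_ofReal (z : ℂ) (t : ℝ) : ‖Complex.exp (z * t)‖ = Real.exp (z.re * t) := by
  rw [Complex.norm_exp]
  simp

theorem norm_stableMultiplier_lt_one (hA2 : ∀ n, (lam n).re ≠ 0) (hτ : 0 < τ) (n : ℕ) :
    ‖stableMultiplier lam τ n‖ < 1 := by
  unfold stableMultiplier
  split_ifs with h
  · simp
  · rw [norm_exp_mul_ofReal, Real.exp_lt_one_iff]
    exact mul_neg_of_neg_of_pos (lt_of_le_of_ne (not_lt.1 h) (hA2 n)) hτ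

/-- The set Ω lies in Re ≤ 0, so eigenvalues in the open right half-plane are among the finitely
many exceptions of (A1). -/
theorem finite_re_pos (hinj : Function.Injective lam) (hω : 0 < ω) (hΥ : 0 < Υ)
    (hA1 : (Set.range lam ∩ ({z : ℂ | -ω < z.re} ∩ (OmegaSet α Υ)ᶜ)).Finite) :
    {n | 0 < (lam n).re}.Finite := by
  refine (hA1.preimage hinj.injOn).subset fun n hn => ?_
  have hn' : 0 < (lam n).re := hn
  refine ⟨⟨n, rfl⟩, (by linarith : -ω < (lam n).re), fun h => ?_⟩
  have h1 : (lam n).re ≤ -Υ / |(lam n).im| ^ α := h.2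
  have h2 : -Υ / |(lam n).im| ^ α ≤ 0 := div_nonpos_of_nonpos_of_nonneg (by linarith) (by positivity)
  linarith

/-- (A1) transported from the half-plane to the disc: how fast the eigenvalues of T(τ) may approach
the unit circle in terms of |λₙ|. -/
theorem exists_rpow_neg_le (hinj : Function.Injective lam) (hω : 0 < ω) (hα : 0 < α) (hΥ : 0 < Υ)
    (hA1 : (Set.range lam ∩ ({z : ℂ | -ω < z.re} ∩ (OmegaSet α Υ)ᶜ)).Finite)
    (hA2 : ∀ n, (lam n).re ≠ 0) (hτ : 0 < τ) :
    ∃ K : ℝ, 0 < K ∧ ∀ n, ‖lam n‖ ^ (-α) ≤ K * (1 - ‖stableMultiplier lam τ n‖) := by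
  have hexc := hA1.preimage hinj.injOn (f := lam)
  obtain ⟨K₀, hK₀⟩ := (hexc.image fun n =>
    ‖lam n‖ ^ (-α) / (1 - ‖stableMultiplier lam τ n‖)).bddAbove
  have hexp : Real.exp (-ω * τ) < 1 := by
    rw [Real.exp_lt_one_iff]
    nlinarith
  -- One constant for each class: K₀ for the finitely many exceptions, K₁ for Re λₙ ≤ -ω, and K₂ for
  -- eigenvalues of Ω in the strip. In the last class y = -τ Re λₙ ≤ ωτ, and 1 - e^{-y} ≥ y/(1 + y)
  -- ≥ y/(1 + ωτ).
  set K₁ := ω ^ (-α) / (1 - Real.exp (-ω * τ)) with hK₁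
  set K₂ := (1 + ω * τ) / (τ * Υ) with hK₂
  have hK₁0 : 0 ≤ K₁ := div_nonneg (by positivity) (by linarith)
  have hK₂0 : 0 < K₂ := by positivity
  refine ⟨|K₀| + K₁ + K₂, by positivity, fun n => ?_⟩
  have hq := norm_stableMultiplier_lt_one hA2 hτ n
  have hq' : 0 < 1 - ‖stableMultiplier lam τ n‖ := by linarith
  by_cases hn : n ∈ lam ⁻¹' (Set.range lam ∩ ({z : ℂ | -ω < z.re} ∩ (OmegaSet α Υ)ᶜ))
  · have h1 := hK₀ (Set.mem_image_of_mem _ hn)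
    rw [div_le_iff₀ hq'] at h1
    refine h1.trans (mul_le_mul_of_nonneg_right ?_ hq'.le)
    linarith [le_abs_self K₀]
  · rcases le_or_gt (lam n).re (-ω) with h | h
    · have hneg : ¬ 0 < (lam n).re := by linarith
      have h1 : ω ≤ ‖lam n‖ := by
        have := (neg_le_abs (lam n).re).trans (Complex.abs_re_le_norm (lam n))
        linarith
      have h2 : ‖lam n‖ ^ (-α) ≤ ω ^ (-α) :=
        Real.rpow_le_rpow_of_nonpos hω h1 (by linarith)
      have h3 : 1 - Real.exp (-ω * τ) ≤ 1 - ‖stableMultiplier lam τ n‖ := by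
        rw [stableMultiplier, if_neg hneg, norm_exp_mul_ofReal]
        gcongr
      calc ‖lam n‖ ^ (-α) ≤ ω ^ (-α) := h2
        _ = K₁ * (1 - Real.exp (-ω * τ)) := by
          rw [hK₁, div_mul_cancel₀]
          linarith
        _ ≤ K₁ * (1 - ‖stableMultiplier lam τ n‖) := by gcongr
        _ ≤ _ := mul_le_mul_of_nonneg_right (by linarith [abs_nonneg K₀]) hq'.le
    · have hom : lam n ∈ OmegaSet α Υ := by
        by_contra hc
        exact hn ⟨⟨n, rfl⟩, h, hc⟩
      obtain ⟨him, hre⟩ := hom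
      have him' : 0 < |(lam n).im| := abs_pos.2 him
      have hpos : 0 < ‖lam n‖ := him'.trans_le (Complex.abs_im_le_norm _)
      have h1 : Υ * ‖lam n‖ ^ (-α) ≤ -(lam n).re := by
        have h2 : ‖lam n‖ ^ (-α) ≤ |(lam n).im| ^ (-α) :=
          Real.rpow_le_rpow_of_nonpos him' (Complex.abs_im_le_norm _) (by linarith)
        have h3 : -Υ / |(lam n).im| ^ α = -(Υ * |(lam n).im| ^ (-α)) := by
          rw [Real.rpow_neg him'.le]
          ring
        rw [h3] at hre
        nlinarith
      have hre0 : 0 < -(lam n).re := lt_of_lt_of_le (by positivity) h1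
      have hneg : ¬ 0 < (lam n).re := by linarith
      set y := -(lam n).re * τ with hy
      have hy0 : 0 < y := by positivity
      have hy1 : y ≤ ω * τ := by
        rw [hy]
        gcongr
        linarith
      have h4 : y / (1 + ω * τ) ≤ 1 - ‖stableMultiplier lam τ n‖ := by
        have e : (lam n).re * τ = -y := by rw [hy]; ring
        rw [stableMultiplier, if_neg hneg, norm_exp_mul_ofReal, e, Real.exp_neg]
        have h5 : 1 + y ≤ Real.exp y := by linarith [Real.add_one_le_exp y]
        have h6 : (Real.exp y)⁻¹ ≤ (1 + y)⁻¹ := inv_anti₀ (by positivity) h5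
        have h7 : y / (1 + ω * τ) ≤ y / (1 + y) := by gcongr
        have h8 : y / (1 + y) = 1 - (1 + y)⁻¹ := by
          field_simp
          ring
        linarith
      calc ‖lam n‖ ^ (-α) = (Υ * ‖lam n‖ ^ (-α)) / Υ := by field_simp
        _ ≤ -(lam n).re / Υ := by gcongr
        _ = K₂ * (y / (1 + ω * τ)) := by
          rw [hK₂, hy]
          field_simp
        _ ≤ K₂ * (1 - ‖stableMultiplier lam τ n‖) := by gcongr
        _ ≤ _ := mul_le_mul_of_nonneg_right (by linarith [abs_nonneg K₀]) hq'.le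

theorem exists_le_norm_of_rpow_neg_le (hα : 0 < α) {K : ℝ} (hK : 0 < K) (h0 : ∀ n, lam n ≠ 0)
    (h : ∀ n, ‖lam n‖ ^ (-α) ≤ K) : ∃ c : ℝ, 0 < c ∧ ∀ n, c ≤ ‖lam n‖ := by
  refine ⟨K ^ (-α⁻¹), by positivity, fun n => ?_⟩
  have hpos := norm_pos_iff.2 (h0 n)
  have h1 := Real.rpow_le_rpow_of_nonpos (by positivity) (h n) (show -α⁻¹ ≤ 0 by
    rw [neg_nonpos]; positivity)
  rwa [← Real.rpow_mul hpos.le, neg_mul_neg, mul_inv_cancel₀ hα.ne', Real.rpow_one] at h1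

/-- Nothing changes for stable indices. For the finitely many unstable ones, |z - pₙ| is at least
(|pₙ| - 1)/2 once r is close to 1, while |z - 0| = r < 2. -/
theorem exists_norm_sub_stableMultiplier_le (hfin : {n | 0 < (lam n).re}.Finite) (hτ : 0 < τ) :
    ∃ K : ℝ, 0 < K ∧ ∀ᶠ r in 𝓝[>] (1 : ℝ), ∀ θ n,
      ‖circlePt r θ - stableMultiplier lam τ n‖ ≤ K * ‖circlePt r θ - Complex.exp (lam n * τ)‖ := by
  have hgt : ∀ n, 0 < (lam n).re → 1 < Real.exp ((lam n).re * τ) := fun n hn =>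
    Real.one_lt_exp_iff.2 (by positivity)
  obtain ⟨K₀, hK₀⟩ := (hfin.image fun n => 4 / (Real.exp ((lam n).re * τ) - 1)).bddAbove
  refine ⟨|K₀| + 1, by positivity, ?_⟩
  have hev : ∀ᶠ r in 𝓝[>] (1 : ℝ), ∀ n ∈ {n | 0 < (lam n).re},
      r - 1 < (Real.exp ((lam n).re * τ) - 1) / 2 := by
    rw [hfin.eventually_all]
    intro n hn
    have := hgt n hn
    filter_upwards [Ioo_mem_nhdsGT (show (1 : ℝ) < 1 + (Real.exp ((lam n).re * τ) - 1) / 2 by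
      linarith)] with r hr
    linarith [hr.2]
  filter_upwards [hev, Ioo_mem_nhdsGT (show (1 : ℝ) < 2 by norm_num)] with r hr hr2 θ n
  unfold stableMultiplier
  split_ifs with hn
  · have h1 := hr n hn
    have h2 := hgt n hn
    have h3 : (Real.exp ((lam n).re * τ) - 1) / 2 ≤
        ‖circlePt r θ - Complex.exp (lam n * τ)‖ := by
      have h4 := norm_sub_norm_le (Complex.exp (lam n * τ)) (circlePt r θ)
      rw [norm_exp_mul_ofReal, norm_circlePt (by linarith [hr2.1]), norm_sub_rev] at h4
      linarith
    have h5 := hK₀ (Set.mem_image_of_mem _ hn)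
    rw [sub_zero, norm_circlePt (by linarith [hr2.1])]
    calc r ≤ 4 / (Real.exp ((lam n).re * τ) - 1) * ((Real.exp ((lam n).re * τ) - 1) / 2) := by
          have : Real.exp ((lam n).re * τ) - 1 ≠ 0 := by linarith
          have e : 4 / (Real.exp ((lam n).re * τ) - 1) *
            ((Real.exp ((lam n).re * τ) - 1) / 2) = 2 := by
            field_simp
            norm_num
          rw [e]
          exact hr2.2.le
      _ ≤ (|K₀| + 1) * ‖circlePt r θ - Complex.exp (lam n * τ)‖ := by
          refine mul_le_mul ?_ h3 (by linarith) (by positivity)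
          linarith [le_abs_self K₀]
  · exact le_mul_of_one_le_left (norm_nonneg _) (by linarith [abs_nonneg K₀])

/-- The integral equals (exp(λₙτ) - 1)/λₙ, with bounded numerator because only finitely many Re λₙ
are positive. Sampling thus gains one power of |λₙ| on the input side. -/
theorem exists_norm_integral_exp_le (hfin : {n | 0 < (lam n).re}.Finite) (h0 : ∀ n, lam n ≠ 0)
    (hτ : 0 < τ) : ∃ K : ℝ, 0 < K ∧ ∀ n,
      ‖∫ s in (0 : ℝ)..τ, Complex.exp (lam n * s)‖ ≤ K * ‖lam n‖⁻¹ := by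
  obtain ⟨K₀, hK₀⟩ := (hfin.image fun n => Real.exp ((lam n).re * τ)).bddAbove
  refine ⟨|K₀| + 2, by positivity, fun n => ?_⟩
  rw [integral_exp_mul_complex (h0 n), norm_div, div_eq_mul_inv]
  gcongr
  refine (norm_sub_le _ _).trans ?_
  rw [norm_exp_mul_ofReal]
  have h1 : Real.exp ((lam n).re * τ) ≤ |K₀| + 1 := by
    by_cases hn : 0 < (lam n).re
    · have := hK₀ (Set.mem_image_of_mem _ (show n ∈ {n | 0 < (lam n).re} from hn))
      linarith [le_abs_self K₀]
    · have : Real.exp ((lam n).re * τ) ≤ 1 :=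
        Real.exp_le_one_iff.2 (mul_nonpos_of_nonpos_of_nonneg (not_lt.1 hn) hτ.le)
      linarith [abs_nonneg K₀]
  have h2 : ‖Complex.exp (lam n * (0 : ℝ))‖ = 1 := by simp
  rw [h2]
  linarith

theorem rpow_le_mul_rpow {c x a b : ℝ} (hc : 0 < c) (hx : c ≤ x) (hab : a ≤ b) :
    x ^ a ≤ c ^ (a - b) * x ^ b := by
  have hx0 : 0 < x := hc.trans_le hx
  calc x ^ a = x ^ (a - b) * x ^ b := by rw [← Real.rpow_add hx0, sub_add_cancel]
    _ ≤ _ := mul_le_mul_of_nonneg_right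
      (Real.rpow_le_rpow_of_nonpos hc hx (by linarith)) (by positivity)

theorem summable_mul_rpow_of_le {c a b : ℝ} {k x : ℕ → ℝ} (hc : 0 < c) (hx : ∀ n, c ≤ x n)
    (hk : ∀ n, 0 ≤ k n) (hab : a ≤ b) (h : Summable fun n => k n * x n ^ b) :
    Summable fun n => k n * x n ^ a := by
  have hx0 : ∀ n, 0 < x n := fun n => hc.trans_le (hx n)
  refine Summable.of_nonneg_of_le (fun n => mul_nonneg (hk n) (Real.rpow_nonneg (hx0 n).le _))
    (fun n => ?_) (h.mul_left (c ^ (a - b)))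
  calc k n * x n ^ a ≤ k n * (c ^ (a - b) * x n ^ b) :=
        mul_le_mul_of_nonneg_left (rpow_le_mul_rpow hc (hx n) hab) (hk n)
    _ = _ := by ring

/-- The choice of the exponent that splits the smoothing between input and output. -/
theorem exists_input_exponent {c β γ δ K : ℝ} {k b x : ℕ → ℝ} (hc : 0 < c) (hx : ∀ n, c ≤ x n)
    (hb0 : ∀ n, 0 ≤ b n) (hk0 : ∀ n, 0 ≤ k n) (hk : ∀ n, k n ≤ K * (x n)⁻¹)
    (hbs : Summable b) (hb : Summable fun n => b n * x n ^ (2 * β)) (hγ : 0 ≤ γ)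
    (hβγ : α ≤ β + γ) (hδα : δ ≤ α) (hcase : δ ≤ 1 ∨ δ ≤ β) :
    ∃ a, δ ≤ a ∧ a ≤ α ∧ α - a ≤ γ ∧ Summable fun n => (b n * k n ^ 2) * x n ^ (2 * a) := by
  have hx0 : ∀ n, 0 < x n := fun n => hc.trans_le (hx n)
  have hpt : ∀ (e : ℝ) n, (b n * k n ^ 2) * x n ^ e ≤ K ^ 2 * (b n * x n ^ (e - 2)) := by
    intro e n
    have h1 : k n ^ 2 ≤ (K * (x n)⁻¹) ^ 2 := pow_le_pow_left₀ (hk0 n) (hk n) 2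
    have h2 : x n ^ (e - 2) = x n ^ e * ((x n)⁻¹) ^ 2 := by
      rw [Real.rpow_sub (hx0 n), Real.rpow_two, inv_pow, div_eq_mul_inv]
    calc (b n * k n ^ 2) * x n ^ e ≤ (b n * (K * (x n)⁻¹) ^ 2) * x n ^ e :=
          mul_le_mul_of_nonneg_right (mul_le_mul_of_nonneg_left h1 (hb0 n))
            (Real.rpow_nonneg (hx0 n).le _)
      _ = _ := by rw [h2]; ring
  have hsum : ∀ e : ℝ, (Summable fun n => b n * x n ^ (e - 2)) →
      Summable fun n => (b n * k n ^ 2) * x n ^ e := fun e he =>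
    Summable.of_nonneg_of_le (fun n => mul_nonneg (mul_nonneg (hb0 n) (by positivity))
      (Real.rpow_nonneg (hx0 n).le _)) (hpt e) (he.mul_left _)
  -- If β ≥ δ, the regularity of b alone gives a = min(β, α). Otherwise a = δ ≤ 1, and the gain from
  -- the time integral replaces regularity: 2δ - 2 ≤ 0, so square summability of the coordinates of
  -- b is enough.
  by_cases hβδ : δ ≤ β
  · refine ⟨min β α, le_min hβδ hδα, min_le_right _ _, ?_, hsum _ ?_⟩
    · rcases le_total β α with h | h
      · rw [min_eq_left h]; linarith
      · rw [min_eq_right h]; linarith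
    · exact summable_mul_rpow_of_le hc hx hb0 (by linarith [min_le_left β α]) hb
  · have h1 : δ ≤ 1 := hcase.resolve_right hβδ
    refine ⟨δ, le_rfl, hδα, by linarith [not_le.1 hβδ], hsum _ ?_⟩
    exact summable_mul_rpow_of_le hc hx hb0 (b := 0) (by linarith) (by simpa using hbs)

end SpectralBounds

/-! ### Input and output norms as sums over the spectrum -/

section OperatorBounds

variable {X : Type*} [NormedAddCommGroup X] [InnerProductSpace ℂ X] [CompleteSpace X]
  {E : Type*} [NormedAddCommGroup E] [NormedSpace ℂ E]
  {φ ψ : ℕ → X} {ι : E →ₗᵢ[ℂ] X} {N : Set ℕ}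

open Classical in
-- Cauchy–Schwarz in coordinates, followed by |z - pₙ|⁻¹ ≤ K|z - qₙ|⁻¹. The constant does not depend
-- on z, and the map `D` leaves room for both the identity and the fractional power.
theorem exists_norm_sq_output_le (hφ : IsRieszBasis φ) (hψ : Biorthogonal φ ψ)
    (hι : IsCoordSubspace ψ ι N) {p : ℕ → ℂ} {L : E →L[ℂ] E} (hL : HasMultipliers ψ ι p L)
    (F : X →L[ℂ] ℂ) {K : ℝ} (hK : 0 < K) (q : ℕ → ℂ) :
    ∃ C : ℝ, 0 ≤ C ∧ ∀ (D : E → E) (d : ℕ → ℝ),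
      (∀ n ∈ N, ∀ x, ‖(inner ℂ (ψ n) (ι (D x)) : ℂ)‖ ≤ d n * ‖(inner ℂ (ψ n) (ι x) : ℂ)‖) →
      ∀ (z : ℂ) (c : ℝ), 0 < c → (∀ n, c ≤ ‖z - q n‖) →
      (∀ n, ‖z - q n‖ ≤ K * ‖z - p n‖) → ∀ W : E →L[ℂ] ℂ,
      (∀ x, W x = F (ι (resolvent L z (D x)))) →
      (Summable fun n => ‖F (φ n)‖ ^ 2 * (if n ∈ N then d n else 0) ^ 2 * (‖z - q n‖⁻¹) ^ 2) →
      ‖W‖ ^ 2 ≤ C * ∑' n, ‖F (φ n)‖ ^ 2 * (if n ∈ N then d n else 0) ^ 2 * (‖z - q n‖⁻¹) ^ 2 := by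
  obtain ⟨C, hC, h⟩ := hφ.norm_functional_le hψ
  refine ⟨C * K ^ 2, by positivity, fun D d hD z c hc hzq hqp W hW hs => ?_⟩
  have hzp : ∀ n ∈ N, K⁻¹ * c ≤ ‖z - p n‖ := fun n _ => by
    rw [inv_mul_le_iff₀ hK]
    exact (hzq n).trans (hqp n)
  obtain ⟨-, hres⟩ := hL.resolvent hφ hψ hι (by positivity : 0 < K⁻¹ * c) hzp
  have hinv : ∀ n ∈ N, ‖(z - p n)⁻¹‖ ≤ K * ‖z - q n‖⁻¹ := fun n hn => by
    have h1 : 0 < ‖z - q n‖ := hc.trans_le (hzq n)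
    have h2 : 0 < ‖z - p n‖ := (by positivity : 0 < K⁻¹ * c).trans_le (hzp n hn)
    rw [norm_inv, ← div_eq_mul_inv, le_div_iff₀ h1, inv_mul_le_iff₀ h2, mul_comm]
    exact hqp n
  have e : ∀ n, ‖F (φ n)‖ ^ 2 * ((if n ∈ N then d n else 0) * (K * ‖z - q n‖⁻¹)) ^ 2 =
      K ^ 2 * (‖F (φ n)‖ ^ 2 * (if n ∈ N then d n else 0) ^ 2 * (‖z - q n‖⁻¹) ^ 2) := fun n => by
    ring
  have hW2 : ‖W‖ ≤ √(C * ∑' n, ‖F (φ n)‖ ^ 2 *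
      ((if n ∈ N then d n else 0) * (K * ‖z - q n‖⁻¹)) ^ 2) := by
    refine W.opNorm_le_bound (Real.sqrt_nonneg _) fun x => ?_
    rw [hW, ← ι.norm_map x]
    refine h F _ (ι x) _ (fun n => ?_) ?_
    · by_cases hn : n ∈ N
      · rw [hres n hn, norm_mul, if_pos hn]
        calc _ ≤ (K * ‖z - q n‖⁻¹) * (d n * ‖(inner ℂ (ψ n) (ι x) : ℂ)‖) :=
              mul_le_mul (hinv n hn) (hD n hn x) (norm_nonneg _) (by positivity)
          _ = _ := by ring
      · rw [hι.coord_eq_zero _ hn, hι.coord_eq_zero _ hn, if_neg hn]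
        simp
    · simp only [e]
      exact hs.mul_left _
  calc ‖W‖ ^ 2 ≤ (√(C * ∑' n, ‖F (φ n)‖ ^ 2 *
      ((if n ∈ N then d n else 0) * (K * ‖z - q n‖⁻¹)) ^ 2)) ^ 2 :=
        pow_le_pow_left₀ (norm_nonneg _) hW2 2
    _ = _ := by
      rw [Real.sq_sqrt (mul_nonneg hC.le (tsum_nonneg fun n => by positivity))]
      simp only [e]
      rw [tsum_mul_left, mul_assoc]

/-- The input space is one-dimensional, so the norm is that of a single vector, whose coordinates
are (z - pₙ)⁻¹ kₙ ⟨b, ψₙ⟩. -/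
theorem exists_norm_sq_input_le (hφ : IsRieszBasis φ) (hψ : Biorthogonal φ ψ) {p : ℕ → ℂ}
    {L : X →L[ℂ] X} (hL : HasMultipliers ψ (LinearIsometry.id : X →ₗᵢ[ℂ] X) p L)
    {S : ℂ →L[ℂ] X} {b : X} {k : ℕ → ℂ}
    (hS : ∀ n u, (inner ℂ (ψ n) (S u) : ℂ) = k n * inner ℂ (ψ n) b * u) {K : ℝ} (hK : 0 < K)
    (q : ℕ → ℂ) :
    ∃ C : ℝ, 0 ≤ C ∧ ∀ (z : ℂ) (c : ℝ), 0 < c → (∀ n, c ≤ ‖z - q n‖) →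
      (∀ n, ‖z - q n‖ ≤ K * ‖z - p n‖) →
      (Summable fun n => ‖(inner ℂ (ψ n) b : ℂ)‖ ^ 2 * ‖k n‖ ^ 2 * (‖z - q n‖⁻¹) ^ 2) →
      ‖resolvent L z ∘L S‖ ^ 2 ≤
        C * ∑' n, ‖(inner ℂ (ψ n) b : ℂ)‖ ^ 2 * ‖k n‖ ^ 2 * (‖z - q n‖⁻¹) ^ 2 := by
  obtain ⟨C, hC, h⟩ := hφ.norm_equiv hψ
  refine ⟨C * K ^ 2, by positivity, fun z c hc hzq hqp hs => ?_⟩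
  have hzp : ∀ n ∈ Set.univ, K⁻¹ * c ≤ ‖z - p n‖ := fun n _ => by
    rw [inv_mul_le_iff₀ hK]
    exact (hzq n).trans (hqp n)
  obtain ⟨-, hres⟩ := hL.resolvent hφ hψ isCoordSubspace_id (by positivity : 0 < K⁻¹ * c) hzp
  have hinv : ∀ n, ‖(z - p n)⁻¹‖ ≤ K * ‖z - q n‖⁻¹ := fun n => by
    have h1 : 0 < ‖z - q n‖ := hc.trans_le (hzq n)
    have h2 : 0 < ‖z - p n‖ := (by positivity : 0 < K⁻¹ * c).trans_le (hzp n trivial)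
    rw [norm_inv, ← div_eq_mul_inv, le_div_iff₀ h1, inv_mul_le_iff₀ h2, mul_comm]
    exact hqp n
  set σ := ∑' n, ‖(inner ℂ (ψ n) b : ℂ)‖ ^ 2 * ‖k n‖ ^ 2 * (‖z - q n‖⁻¹) ^ 2 with hσ
  have hσ0 : 0 ≤ σ := tsum_nonneg fun n => by positivity
  have hb : ‖resolvent L z ∘L S‖ ≤ √(C * K ^ 2 * σ) := by
    refine ContinuousLinearMap.opNorm_le_bound _ (Real.sqrt_nonneg _) fun u => ?_
    refine le_of_sq_le_sq ?_ (by positivity)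
    rw [mul_pow, Real.sq_sqrt (by positivity)]
    refine ((h _).1).trans ?_
    have h1 : ∑' n, ‖(inner ℂ (ψ n) ((resolvent L z ∘L S) u) : ℂ)‖ ^ 2 ≤
        ∑' n, K ^ 2 * ‖u‖ ^ 2 * (‖(inner ℂ (ψ n) b : ℂ)‖ ^ 2 * ‖k n‖ ^ 2 *
          (‖z - q n‖⁻¹) ^ 2) := by
      refine (hφ.summable_coord hψ _).tsum_le_tsum (fun n => ?_) (hs.mul_left _)
      have h2 := hres n trivial (S u)
      simp only [LinearIsometry.id_apply] at h2
      rw [ContinuousLinearMap.comp_apply, h2, hS, norm_mul, norm_mul, norm_mul]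
      calc (‖(z - p n)⁻¹‖ * (‖k n‖ * ‖(inner ℂ (ψ n) b : ℂ)‖ * ‖u‖)) ^ 2
          ≤ (K * ‖z - q n‖⁻¹ * (‖k n‖ * ‖(inner ℂ (ψ n) b : ℂ)‖ * ‖u‖)) ^ 2 := by
            gcongr
            exact hinv n
        _ = _ := by ring
    rw [tsum_mul_left] at h1
    calc _ ≤ C * (K ^ 2 * ‖u‖ ^ 2 * σ) := by gcongr
      _ = _ := by ring
  calc _ ≤ (√(C * K ^ 2 * σ)) ^ 2 := pow_le_pow_left₀ (norm_nonneg _) hb 2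
    _ = _ := Real.sq_sqrt (by positivity)

end OperatorBounds

/-! ### Assembling the limits -/

section Main

variable {X : Type*} [NormedAddCommGroup X] [InnerProductSpace ℂ X] [CompleteSpace X]
  {E : Type*} [NormedAddCommGroup E] [NormedSpace ℂ E]
  {φ ψ : ℕ → X} {ι : E →ₗᵢ[ℂ] X} {N : Set ℕ}

theorem eventually_circlePt_mem_resolventSet (hφ : IsRieszBasis φ) (hψ : Biorthogonal φ ψ)
    (hι : IsCoordSubspace ψ ι N) {p q : ℕ → ℂ} {L : E →L[ℂ] E} (hL : HasMultipliers ψ ι p L)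
    (hq : ∀ n, ‖q n‖ < 1) {K : ℝ} (hK : 0 < K)
    (hqp : ∀ᶠ r in 𝓝[>] (1 : ℝ), ∀ θ n, ‖circlePt r θ - q n‖ ≤ K * ‖circlePt r θ - p n‖) :
    ∀ᶠ r in 𝓝[>] (1 : ℝ), ∀ θ : ℝ, circlePt r θ ∈ resolventSet ℂ L := by
  filter_upwards [hqp, self_mem_nhdsWithin] with r hr hr1 θ
  have hr1' : 1 < r := hr1
  have hpos : 0 < r - 1 := by linarith
  refine (hL.resolvent hφ hψ hι (c := K⁻¹ * (r - 1)) (by positivity) fun n _ => ?_).1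
  rw [inv_mul_le_iff₀ hK]
  refine le_trans ?_ (hr θ n)
  have := sub_norm_le_norm_circlePt_sub (r := r) (by linarith) θ (q n)
  linarith [hq n]

open Classical in
-- Common form of the three limits: `E` is X, X⁺ or X⁻, and `D` is the identity or the fractional
-- power. What is left to the application is the summability of the two weighted coefficient
-- sequences.
theorem tendsto_weightLambda_input_output (hφ : IsRieszBasis φ) (hψ : Biorthogonal φ ψ)
    {p q : ℕ → ℂ} {LX : X →L[ℂ] X}
    (hLX : HasMultipliers ψ (LinearIsometry.id : X →ₗᵢ[ℂ] X) p LX)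
    (hq : ∀ n, ‖q n‖ < 1) {K : ℝ} (hK : 0 < K)
    (hqp : ∀ᶠ r in 𝓝[>] (1 : ℝ), ∀ θ n, ‖circlePt r θ - q n‖ ≤ K * ‖circlePt r θ - p n‖)
    {α K' : ℝ} {l : ℕ → ℝ} (hα : 0 < α) (hl : ∀ n, 0 < l n) (hK' : 0 < K')
    (hlq : ∀ n, l n ^ (-α) ≤ K' * (1 - ‖q n‖)) {S : ℂ →L[ℂ] X} {b : X} {k : ℕ → ℂ}
    (hS : ∀ n u, (inner ℂ (ψ n) (S u) : ℂ) = k n * inner ℂ (ψ n) b * u)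
    (hι : IsCoordSubspace ψ ι N) {L : E →L[ℂ] E} (hL : HasMultipliers ψ ι p L) (F : X →L[ℂ] ℂ)
    {D : E → E} {d : ℕ → ℝ}
    (hD : ∀ n ∈ N, ∀ x, ‖(inner ℂ (ψ n) (ι (D x)) : ℂ)‖ ≤ d n * ‖(inner ℂ (ψ n) (ι x) : ℂ)‖)
    {W : ℝ → ℝ → E →L[ℂ] ℂ}
    (hW : ∀ r θ x, W r θ x = F (ι (resolvent L (circlePt r θ) (D x))))
    {δ a : ℝ} (hδ : 0 ≤ δ) (hδα : δ ≤ α / 2) (hδa : δ ≤ a) (haα : a ≤ α)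
    (hg : Summable fun n => (‖(inner ℂ (ψ n) b : ℂ)‖ ^ 2 * ‖k n‖ ^ 2) * l n ^ (2 * a))
    (hh : Summable fun n => (‖F (φ n)‖ ^ 2 * (if n ∈ N then d n else 0) ^ 2) *
      l n ^ (2 * (α - a + δ))) :
    Tendsto (fun r : ℝ => weightLambda (δ / α) r * ∫ θ in (0 : ℝ)..(2 * Real.pi),
      ‖resolvent LX (circlePt r θ) ∘L S‖ ^ 2 * ‖W r θ‖ ^ 2) (𝓝[>] 1) (𝓝 0) := by
  obtain ⟨C₁, hC₁, h₁⟩ := exists_norm_sq_input_le hφ hψ hLX hS hK q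
  obtain ⟨C₂, hC₂, h₂⟩ := exists_norm_sq_output_le hφ hψ hι hL F hK q
  have hδe : δ / α * α = δ := div_mul_cancel₀ _ hα.ne'
  have hge : ∀ r : ℝ, 1 < r → ∀ θ n, r - 1 ≤ ‖circlePt r θ - q n‖ := fun r hr θ n => by
    have := sub_norm_le_norm_circlePt_sub (r := r) (by linarith) θ (q n)
    linarith [hq n]
  refine tendsto_weightLambda_mul_integral_mul (C := C₁ + C₂) (a := a) (by positivity)
    (by rw [div_le_iff₀ hα]; linarith) hα (by rwa [hδe]) haα hK' (by positivity) hq hl hlq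
    (g := fun n => ‖(inner ℂ (ψ n) b : ℂ)‖ ^ 2 * ‖k n‖ ^ 2)
    (h := fun n => ‖F (φ n)‖ ^ 2 * (if n ∈ N then d n else 0) ^ 2)
    (fun n => by positivity) (fun n => by positivity) hg (by rw [hδe]; exact hh)
    (fun r θ => by positivity) (fun r θ => by positivity) ?_ ?_
  · filter_upwards [hqp, self_mem_nhdsWithin] with r hr hr1 θ hs
    refine (h₁ _ (r - 1) (sub_pos.2 hr1) (hge r hr1 θ) (hr θ) hs).trans ?_
    exact mul_le_mul_of_nonneg_right (by linarith) (tsum_nonneg fun n => by positivity)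
  · filter_upwards [hqp, self_mem_nhdsWithin] with r hr hr1 θ hs
    refine (h₂ D d hD _ (r - 1) (sub_pos.2 hr1) (hge r hr1 θ) (hr θ) _ (hW r θ) hs).trans ?_
    exact mul_le_mul_of_nonneg_right (by linarith) (tsum_nonneg fun n => by positivity)

end Main

end SampledData

theorem mainTheorem4 {X : Type*} [NormedAddCommGroup X] [InnerProductSpace ℂ X] [CompleteSpace X]
    -- the Riesz-spectral generator, its eigendata, and the semigroup it generates
    (A : X →ₗ.[ℂ] X) (lam : ℕ → ℂ) (φ ψ : ℕ → X)
    (hA : IsRieszSpectral A lam φ) (hψ : Biorthogonal φ ψ)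
    (T : C0Semigroup X) (hT : T.IsGenerator A)
    -- the control operator and the feedback operator
    (b f : X) (B : ℂ →L[ℂ] X) (F : X →L[ℂ] ℂ)
    (hB : ∀ u : ℂ, B u = u • b) (hF : ∀ x : X, F x = inner ℂ f x)
    -- (A1)
    (ω α Υ : ℝ) (hω : 0 < ω) (hα : 0 < α) (hΥ : 0 < Υ)
    (hA1 : (Set.range lam ∩ ({z : ℂ | -ω < z.re} ∩ (OmegaSet α Υ)ᶜ)).Finite)
    -- (A2)
    (hA2 : ∀ n : ℕ, (lam n).re ≠ 0)
    (β γ : ℝ) (hβ : 0 ≤ β) (hγ : 0 ≤ γ) (hβγ : α ≤ β + γ)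
    (hb : b ∈ weightedDomain lam ψ β) (hf : f ∈ weightedDomain lam φ γ)
    (τ : ℝ) (hτ : 0 < τ) :
    -- (a)
    ((∀ᶠ r : ℝ in 𝓝[>] 1, ∀ θ : ℝ, circlePt r θ ∈ resolventSet ℂ (T τ)) ∧
      Tendsto (fun r : ℝ => (r - 1) * ∫ θ in (0 : ℝ)..(2 * Real.pi),
          ‖resolvent (T τ) (circlePt r θ) ∘L inputMap T B τ‖ ^ 2 *
            ‖F ∘L resolvent (T τ) (circlePt r θ)‖ ^ 2)
        (𝓝[>] 1) (𝓝 0)) ∧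
    -- (b)
    (∀ δ : ℝ, 0 < δ → δ ≤ α / 2 → (δ ≤ 1 ∨ α ≤ β) →
      ∀ Φ : ℝ → ℂ, IsSeparatingContour A Φ →
        (∀ᶠ r : ℝ in 𝓝[>] 1, ∀ θ : ℝ,
          circlePt r θ ∈ resolventSet ℂ (semigroupPlus hT hτ.le Φ) ∧
            circlePt r θ ∈ resolventSet ℂ (semigroupMinus hT hτ.le Φ)) ∧
        Tendsto (fun r : ℝ => weightLambda (δ / α) r * ∫ θ in (0 : ℝ)..(2 * Real.pi),
            ‖resolvent (T τ) (circlePt r θ) ∘L inputMap T B τ‖ ^ 2 *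
              ‖(F ∘L (plusSpace A Φ).subtypeL) ∘L
                resolvent (semigroupPlus hT hτ.le Φ) (circlePt r θ)‖ ^ 2)
          (𝓝[>] 1) (𝓝 0) ∧
        Tendsto (fun r : ℝ => weightLambda (δ / α) r * ∫ θ in (0 : ℝ)..(2 * Real.pi),
            ‖resolvent (T τ) (circlePt r θ) ∘L inputMap T B τ‖ ^ 2 *
              ‖(F ∘L (minusSpace A Φ).subtypeL) ∘L
                resolvent (semigroupMinus hT hτ.le Φ) (circlePt r θ) ∘L
                  negFracPow (opMinus A Φ) δ‖ ^ 2)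
          (𝓝[>] 1) (𝓝 0)) := by
  have hφ := hA.rieszBasis
  have hfin := finite_re_pos hA.injective hω hΥ hA1
  have h0 : ∀ n, lam n ≠ 0 := fun n h => hA2 n (by simp [h])
  have hq := norm_stableMultiplier_lt_one hA2 hτ
  obtain ⟨K, hK, hlq⟩ := exists_rpow_neg_le hA.injective hω hα hΥ hA1 hA2 hτ
  obtain ⟨c, hc, hcl⟩ := exists_le_norm_of_rpow_neg_le hα hK h0 fun n => (hlq n).trans
    (mul_le_of_le_one_right hK.le (by linarith [norm_nonneg (stableMultiplier lam τ n)]))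
  have hl : ∀ n, 0 < ‖lam n‖ := fun n => hc.trans_le (hcl n)
  obtain ⟨K₂, hK₂, hqp⟩ := exists_norm_sub_stableMultiplier_le hfin hτ
  obtain ⟨K₃, hK₃, hk⟩ := exists_norm_integral_exp_le hfin h0 hτ
  have hS := hA.coord_inputMap hψ hT hB hτ.le
  have hLX := hA.hasMultipliers_semigroup hψ hT hτ.le
  have hFφ : ∀ n, ‖F (φ n)‖ ^ 2 = ‖(inner ℂ (φ n) f : ℂ)‖ ^ 2 := fun n => by
    rw [hF, norm_inner_symm]
  have hFs : ∀ e : ℝ, e ≤ γ → Summable fun n => ‖F (φ n)‖ ^ 2 * ‖lam n‖ ^ (2 * e) := by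
    intro e he
    refine summable_mul_rpow_of_le hc hcl (fun n => by positivity)
      (show 2 * e ≤ 2 * γ by linarith) ?_
    refine Summable.congr hf fun n => ?_
    rw [hFφ, mul_comm]
  have hbs : Summable fun n => ‖(inner ℂ (ψ n) b : ℂ)‖ ^ 2 * ‖lam n‖ ^ (2 * β) :=
    Summable.congr hb fun n => mul_comm _ _
  have hexp := fun (δ : ℝ) (h1 : δ ≤ α) (h2 : δ ≤ 1 ∨ δ ≤ β) =>
    exists_input_exponent hc hcl (fun n => by positivity) (fun n => norm_nonneg _) hk
      (hφ.summable_coord hψ b) hbs hγ hβγ h1 h2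
  refine ⟨⟨eventually_circlePt_mem_resolventSet hφ hψ isCoordSubspace_id hLX hq hK₂ hqp, ?_⟩, ?_⟩
  -- With δ = 0 nothing has to be gained beyond α, and the weight is r - 1 itself.
  · obtain ⟨a, ha0, haα, haγ, hg⟩ := hexp 0 hα.le (Or.inl zero_le_one)
    have h := tendsto_weightLambda_input_output hφ hψ hLX hq hK₂ hqp hα hl hK hlq hS
      isCoordSubspace_id hLX F (D := id) (d := fun _ => 1) (fun n _ x => by simp)
      (W := fun r θ => F ∘L resolvent (T τ) (circlePt r θ)) (fun r θ x => rfl) le_rfl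
      (by positivity) ha0 haα hg (by simpa using hFs _ haγ)
    simpa [weightLambda] using h
  · intro δ hδ hδα hδc Φ hΦ
    have hι₁ := hA.isCoordSubspace_plusSpace hψ hT hΦ
    have hι₂ := hA.isCoordSubspace_minusSpace hψ hT hΦ
    have hL₁ := hA.hasMultipliers_semigroupPlus (Φ := Φ) hψ hT hτ.le
    have hL₂ := hA.hasMultipliers_semigroupMinus (Φ := Φ) hψ hT hτ.le
    -- The alternative α ≤ β implies δ ≤ β, since δ ≤ α/2.
    obtain ⟨a, ha0, haα, haγ, hg⟩ := hexp δ (by linarith)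
      (hδc.imp_right fun h => by linarith)
    refine ⟨?_, ?_, ?_⟩
    · filter_upwards [eventually_circlePt_mem_resolventSet hφ hψ hι₁ hL₁ hq hK₂ hqp,
        eventually_circlePt_mem_resolventSet hφ hψ hι₂ hL₂ hq hK₂ hqp] with r h1 h2 θ
      exact ⟨h1 θ, h2 θ⟩
    · refine tendsto_weightLambda_input_output hφ hψ hLX hq hK₂ hqp hα hl hK hlq hS
        hι₁ hL₁ F (D := id) (d := fun _ => 1) (fun n _ x => by simp)
        (fun r θ x => rfl) hδ.le hδα ha0 haα hg ?_
      -- Only finitely many indices belong to X⁺, so the output weights need no regularity of f.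
      refine summable_of_ne_finset_zero (s := hfin.toFinset) fun n hn => ?_
      rw [hfin.mem_toFinset] at hn
      rw [if_neg hn]
      simp
    · obtain ⟨C, hC, hfrac⟩ := (hA.isDiagonalOp_opMinus (Φ := Φ) hψ hT).coord_negFracPow_le hφ hψ
        hι₂ hc (fun n hn => hn) (fun n _ => hcl n) hδ.le
      refine tendsto_weightLambda_input_output hφ hψ hLX hq hK₂ hqp hα hl hK hlq hS
        hι₂ hL₂ F (D := negFracPow (opMinus A Φ) δ) (d := fun n => C * ‖lam n‖ ^ (-δ)) hfrac
        (fun r θ x => rfl) hδ.le hδα ha0 haα hg ?_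
      -- The decay |λₙ|^{-2δ} of the squared multipliers cancels the surplus |λₙ|^{2δ} in the
      -- weight. The remaining exponent 2(α - a) is at most 2γ, which the regularity of f covers.
      refine Summable.of_nonneg_of_le (fun n => by positivity) (fun n => ?_)
        ((hFs _ haγ).mul_left (C ^ 2))
      have e : ‖lam n‖ ^ (2 * (α - a + δ)) =
          ‖lam n‖ ^ (2 * (α - a)) * (‖lam n‖ ^ δ) ^ 2 := by
        rw [← Real.rpow_natCast, ← Real.rpow_mul (hl n).le, ← Real.rpow_add (hl n)]
        congr 1
        push_cast
        ring
      have e2 : ‖lam n‖ ^ (-δ) * ‖lam n‖ ^ δ = 1 := by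
        rw [← Real.rpow_add (hl n), neg_add_cancel, Real.rpow_zero]
      have h1 : (if n ∈ {n | (lam n).re ≤ 0} then C * ‖lam n‖ ^ (-δ) else 0) ^ 2 ≤
          (C * ‖lam n‖ ^ (-δ)) ^ 2 := by
        split_ifs
        · exact le_rfl
        · rw [zero_pow two_ne_zero]
          positivity
      calc _ ≤ ‖F (φ n)‖ ^ 2 * (C * ‖lam n‖ ^ (-δ)) ^ 2 * ‖lam n‖ ^ (2 * (α - a + δ)) := by
            refine mul_le_mul_of_nonneg_right (mul_le_mul_of_nonneg_left ?_ (by positivity))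
              (by positivity)
            convert h1
        _ = C ^ 2 * (‖F (φ n)‖ ^ 2 * ‖lam n‖ ^ (2 * (α - a))) *
            (‖lam n‖ ^ (-δ) * ‖lam n‖ ^ δ) ^ 2 := by rw [e]; ring
        _ = _ := by rw [e2, one_pow, mul_one]
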